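/- **Setting (guarded recursion with clocks).** Let $\mathbb K$ be the category of finite clock contexts with a distinguished clock: objects are triples $c=(m,\delta,\kappa)$ with $m\in\mathbb N$, $\delta:\{1,\dots,m\}\to\mathbb N$ (the time remaining on each of $m$ clocks) and $\kappa\in\{1,\dots,m\}$; a morphism $(m,\delta,\kappa)\to(m',\delta',\kappa')$ is a map $\sigma:\{1,\dots,m\}\to\{1,\dots,m'\}$ with $\delta'(\sigma(i))\le\delta(i)$ for all $i$ and $\sigma(\kappa)=\kappa'$. Types depending on a clock $\kappa$ are interpreted as functors $X:\mathbb K\to\mathbf{Set}$. If $\delta(\kappa)>0$, write $c^-$ for $c$ with $\delta(\kappa)$ decreased by one. The later modality is $(\triangleright^\kappa X)(c)=X(c^-)$ if $\delta(\kappa)>0$, and a one-point set otherwise. The guarded delay monad $D^\kappa$ on $[\mathbb K,\mathbf{Set}]$ sends $X$ to the solution of $D^\kappa X\cong X+\triangleright^\kappa D^\kappa X$, with inclusions $\mathsf{now}$ and $\mathsf{step}$, unit $\mathsf{now}$, and multiplication given by $\mu(\mathsf{now}\,x)=x$, $\mu(\mathsf{step}\,d)=\mathsf{step}((\triangleright^\kappa\mu)\,d)$.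 The coinductive delay monad $D$ on $\mathbf{Set}$ sends $X$ to the final coalgebra $DX\cong X+DX$; its second inclusion is also called a step, and its unit and multiplication are the analogous ones. **Theories.** An algebraic theory consists of a set of finitary operation symbols and a set of equations $s=t$ between terms in finite variable contexts. An equation is *balanced* if every variable occurs equally often in $s$ and in $t$. A monad $T$ on $\mathbf{Set}$ is *presented* by a theory if it is isomorphic to the free model monad of the theory (terms modulo provable equality); then each $TX$ carries the operations of the theory. Such a $T$ acts on $[\mathbb K,\mathbf{Set}]$ pointwise, $(TX)(c)=T(X(c))$. A *distributive law* of a monad $S$ over a monad $R$ is a natural transformation $SR\to RS$ compatible with the units and multiplications of both. **Sequential lifting.** For an $n$-ary operation $\sigma$ on $X$, its sequential lifting $\sigma^{\mathrm{seq}}:(D^\kappa X)^n\to D^\kappa X$ is defined by $\sigma^{\mathrm{seq}}(\mathsf{now}\,x_1,\dots,\mathsf{now}\,x_n)=\mathsf{now}(\sigma(x_1,\dots,x_n))$ and, when the $i$-th argument $\mathsf{step}\,d$ is the first one not of the form $\mathsf{now}\,x$, by $$\sigma^{\mathrm{seq}}(\mathsf{now}\,x_1,\dots,\mathsf{step}\,d,\dots,x_n)=\mathsf{step}\bigl(\sigma^{\mathrm{seq}}(\mathsf{now}\,x_1,\dots,d,\dots,x_n)\bigr),$$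 where the lifting under $\mathsf{step}$ is taken one tick later. **Theorem.** 1. Let $T$ be a monad on $\mathbf{Set}$ presented by an algebraic theory all of whose equations are balanced (for example its free model monad). Then sequential lifting defines a distributive law of $T$ over the guarded delay monad: there is exactly one distributive law $\zeta:TD^\kappa\to D^\kappa T$ such that, for every $n$-ary operation $\sigma$ of the theory, every $X$, and all $t_1,\dots,t_n\in TD^\kappa X$ at the same stage, $$\zeta(\sigma(t_1,\dots,t_n))=\sigma^{\mathrm{seq}}(\zeta(t_1),\dots,\zeta(t_n)),$$ where $\sigma^{\mathrm{seq}}$ is the sequential lifting of the operation $\sigma$ of $TX$. 2. For a set $X$, regarded as a constant functor on $\mathbb K$, and $c\in\mathbb K$, let $\mathrm{ev}_c:DX\to(D^\kappa X)(c)$ be the map that keeps values and steps, cut off when the time of $c$ on $\kappa$ runs out. These maps identify $DX$ with $\forall\kappa.D^\kappa X$, the set of families $(s_c)_{c\in\mathbb K}$ with $s_c\in(D^\kappa X)(c)$ compatible with all morphisms of $\mathbb K$. The law $\zeta$ of part 1 induces a distributive law for the coinductive delay monad: there is exactly one distributive law $\xi:TD\to DT$ with $\mathrm{ev}_c(\xi_X(t))=\zeta_{X,c}(T(\mathrm{ev}_c)(t))$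 for every set $X$, every $t\in TDX$ and every $c\in\mathbb K$. In other words, $\xi$ is the composite $T(\forall\kappa.D^\kappa X)\to\forall\kappa.T(D^\kappa X)\to\forall\kappa.D^\kappa(TX)$. 3. The theories of magmas with a two-sided unit, of monoids, and of commutative monoids have only balanced equations, and they present the monad of binary trees (either empty, or nonempty binary trees labelled at the leaves), the list monad, and the multiset monad, respectively. So parts 1 and 2 apply to these three monads. -/

import Mathlib

open CategoryTheory

universe u v w

namespace GuardedDelay

/-! ## Algebraic theories and their free model monads -/

/-- Terms over a signature `S` (operation symbols indexed by their arity), variables in `X`. -/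
inductive Term (S : ℕ → Type u) (X : Type v) : Type (max u v)
  | var (x : X) : Term S X
  | op {n : ℕ} (σ : S n) (t : Fin n → Term S X) : Term S X

namespace Term

variable {S : ℕ → Type u} {X : Type v} {Y : Type w}

/-- The interpretation of a term, given an interpretation `I` of the operation symbols on `Y`
and an assignment `ρ` of the variables. -/
def eval (I : ∀ {n : ℕ}, S n → (Fin n → Y) → Y) (ρ : X → Y) : Term S X → Y
  | var x => ρ x
  | op σ t => I σ fun i => (t i).eval I ρ

/-- Simultaneous substitution of terms for variables. -/
def subst (ρ : X → Term S Y) : Term S X → Term S Y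
  | var x => ρ x
  | op σ t => op σ fun i => (t i).subst ρ

/-- The number of occurrences of the variable `x` in a term. -/
def occ [DecidableEq X] (x : X) : Term S X → ℕ
  | var y => if y = x then 1 else 0
  | op _ t => ∑ i, (t i).occ x

theorem eval_subst {Z : Type*} (I : ∀ {n : ℕ}, S n → (Fin n → Z) → Z) (ρ : X → Term S Y)
    (θ : Y → Z) (t : Term S X) :
    (t.subst ρ).eval I θ = t.eval I fun x => (ρ x).eval I θ := by
  induction t with
  | var x => rfl
  | op σ t ih => simp only [subst, eval, ih]

end Term

/-- An algebraic theory: a signature of finitary operation symbols, and a set of equations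
between terms in finite variable contexts. -/
structure AlgTheory where
  /-- operation symbols of each arity -/
  Op : ℕ → Type u
  /-- equations in each finite context of variables -/
  Eqn : ∀ n : ℕ, Set (Term Op (Fin n) × Term Op (Fin n))

namespace AlgTheory

variable (A : AlgTheory.{u})

/-- Every variable occurs equally often on both sides of every equation (so in particular both
sides have the same variables). -/
def IsBalanced : Prop :=
  ∀ (n : ℕ) (s t : Term A.Op (Fin n)), (s, t) ∈ A.Eqn n → ∀ x : Fin n, s.occ x = t.occ x

/-- An interpretation of the operation symbols on `Y` is a model if it satisfies all equations. -/
def IsModel {Y : Type v} (I : ∀ {n : ℕ}, A.Op n → (Fin n → Y) → Y) : Prop :=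
  ∀ (n : ℕ) (s t : Term A.Op (Fin n)), (s, t) ∈ A.Eqn n →
    ∀ ρ : Fin n → Y, s.eval I ρ = t.eval I ρ

/-- Provable equality of terms: the smallest congruence containing all substitution instances of
the equations. -/
inductive Provable (X : Type v) : Term A.Op X → Term A.Op X → Prop
  | ax {n : ℕ} {s t : Term A.Op (Fin n)} (h : (s, t) ∈ A.Eqn n) (ρ : Fin n → Term A.Op X) :
      Provable X (s.subst ρ) (t.subst ρ)
  | refl (t : Term A.Op X) : Provable X t t
  | symm {s t : Term A.Op X} : Provable X s t → Provable X t s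
  | trans {r s t : Term A.Op X} : Provable X r s → Provable X s t → Provable X r t
  | congr {n : ℕ} (σ : A.Op n) {s t : Fin n → Term A.Op X} :
      (∀ i, Provable X (s i) (t i)) → Provable X (.op σ s) (.op σ t)

/-- Provable equality as a setoid. -/
def setoid (X : Type v) : Setoid (Term A.Op X) where
  r := A.Provable X
  iseqv := ⟨.refl, .symm, .trans⟩

/-- The carrier of the free model: terms modulo provable equality. -/
def FreeModel (X : Type v) : Type (max u v) := Quotient (A.setoid X)

namespace FreeModel

variable {A} {X : Type v}

/-- The class of a term. -/
def mk (t : Term A.Op X) : A.FreeModel X := Quotient.mk (A.setoid X) t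

/-- The operations of the free model. -/
noncomputable def op {n : ℕ} (σ : A.Op n) (x : Fin n → A.FreeModel X) : A.FreeModel X :=
  mk (.op σ fun i => (x i).out)

theorem sound {s t : Term A.Op X} (h : A.Provable X s t) :
    (mk s : A.FreeModel X) = mk t := Quotient.sound (s := A.setoid X) h

theorem op_mk {n : ℕ} (σ : A.Op n) (t : Fin n → Term A.Op X) :
    op σ (fun i => (mk (t i) : A.FreeModel X)) = mk (.op σ t) :=
  sound (.congr σ fun i => Quotient.exact (s := A.setoid X) (Quotient.out_eq (mk (t i))))

@[elab_as_elim]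
theorem ind {P : A.FreeModel X → Prop} (h : ∀ t, P (mk t)) (x : A.FreeModel X) : P x :=
  Quotient.ind (s := A.setoid X) h x

theorem eval_op (t : Term A.Op X) {Y : Type w} (ρ : X → Term A.Op Y) :
    t.eval (fun {_} => op (A := A)) (fun x => (mk (ρ x) : A.FreeModel Y)) = mk (t.subst ρ) := by
  induction t with
  | var x => rfl
  | op σ t ih => simp only [Term.eval, Term.subst, ih, op_mk]

theorem isModel : A.IsModel (Y := A.FreeModel X) (fun {_} => op) := by
  intro n s t h ρ
  have e : ρ = fun i => (mk (ρ i).out : A.FreeModel X) := by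
    funext i; exact (Quotient.out_eq (ρ i)).symm
  rw [e, eval_op, eval_op]
  exact sound (.ax h _)

theorem eval_eq_of_provable {Y : Type w} {I : ∀ {n : ℕ}, A.Op n → (Fin n → Y) → Y}
    (hI : A.IsModel I) (ρ : X → Y) {s t : Term A.Op X} (h : A.Provable X s t) :
    s.eval I ρ = t.eval I ρ := by
  induction h with
  | ax h θ => rw [Term.eval_subst, Term.eval_subst]; exact hI _ _ _ h _
  | refl t => rfl
  | symm _ ih => exact ih.symm
  | trans _ _ ih₁ ih₂ => exact ih₁.trans ih₂
  | congr σ _ ih => simp only [Term.eval, ih]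

/-- The homomorphism from the free model to a model which extends a map on generators. -/
def lift {Y : Type w} (I : ∀ {n : ℕ}, A.Op n → (Fin n → Y) → Y) (hI : A.IsModel I) (ρ : X → Y) :
    A.FreeModel X → Y :=
  Quotient.lift (s := A.setoid X) (fun t => t.eval I ρ) fun _ _ h => eval_eq_of_provable hI ρ h

theorem lift_op_mk {Y : Type w} (f : X → A.FreeModel Y) (t : Term A.Op X) :
    lift (fun {_} => op) isModel f (mk t) = t.eval (fun {_} => op (A := A)) f := rfl

theorem lift_eval {Y : Type w} (f : X → A.FreeModel Y) {Z : Type*} (t : Term A.Op Z)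
    (g : Z → A.FreeModel X) :
    lift (fun {_} => op) isModel f (t.eval (fun {_} => op (A := A)) g) =
      t.eval (fun {_} => op (A := A)) fun z => lift (fun {_} => op) isModel f (g z) := by
  have e : g = fun i => (mk (g i).out : A.FreeModel X) := by
    funext i; exact (Quotient.out_eq (g i)).symm
  rw [e, eval_op, lift_op_mk, Term.eval_subst]
  rfl

end FreeModel

/-- The free model monad, with the variables as unit and substitution as bind. -/
noncomputable instance instMonadFreeModel :
    _root_.Monad (fun X : Type u => A.FreeModel X) where
  pure x := FreeModel.mk (.var x)
  bind x f := FreeModel.lift (fun {_} => FreeModel.op) FreeModel.isModel f x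

instance instLawfulMonadFreeModel : LawfulMonad (fun X : Type u => A.FreeModel X) :=
  LawfulMonad.mk'
    (id_map := by
      intro α x
      induction x using FreeModel.ind with
      | h t =>
        have e := FreeModel.eval_op t (fun x : α => (Term.var x : Term A.Op α))
        have e2 : t.subst (fun x : α => (Term.var x : Term A.Op α)) = t := by
          clear e
          induction t with
          | var x => rfl
          | op σ t ih => simp only [Term.subst, ih]
        rw [e2] at e
        exact e)
    (pure_bind := fun _ _ => rfl)
    (bind_assoc := by
      intro α β γ x f g
      induction x using FreeModel.ind with
      | h t => exact FreeModel.lift_eval g t f)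

/-- The free model monad of a theory, as a monad on the category of sets. -/
noncomputable def monad : CategoryTheory.Monad (Type u) :=
  ofTypeMonad (fun X : Type u => A.FreeModel X)

end AlgTheory

/-! ## Distributive laws -/

/-- A distributive law `S T ⟶ T S` of a monad `S` over a monad `T`. -/
@[ext]
structure DistributiveLaw {C : Type u} [Category.{v} C] (S T : CategoryTheory.Monad C) where
  /-- the natural transformation (functors compose in diagrammatic order) -/
  nat : T.toFunctor ⋙ S.toFunctor ⟶ S.toFunctor ⋙ T.toFunctor
  unit_S : ∀ X : C, S.η.app (T.obj X) ≫ nat.app X = T.map (S.η.app X)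
  unit_T : ∀ X : C, S.map (T.η.app X) ≫ nat.app X = T.η.app (S.obj X)
  mul_S : ∀ X : C, S.μ.app (T.obj X) ≫ nat.app X =
    S.map (nat.app X) ≫ nat.app (S.obj X) ≫ T.map (S.μ.app X)
  mul_T : ∀ X : C, S.map (T.μ.app X) ≫ nat.app X =
    nat.app (T.obj X) ≫ T.map (nat.app X) ≫ T.μ.app (S.obj X)

/-! ## The presheaf model of guarded recursion with clocks

A type in a context with a distinguished clock variable `κ` is a covariant presheaf on the
category of finite clock contexts with a distinguished clock: an object is a finite set of clocks,
each with a finite amount of remaining time, together with one of them; a morphism is a map of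
clocks preserving the distinguished one along which remaining time may only decrease. -/

/-- A finite set of clocks with their remaining times, and a distinguished clock. -/
structure ClockCtx : Type where
  /-- the number of clocks -/
  card : ℕ
  /-- the remaining time on each clock -/
  time : Fin card → ℕ
  /-- the distinguished clock -/
  clk : Fin card

namespace ClockCtx

/-- Morphisms rename clocks, preserve the distinguished one, and do not increase time. -/
@[ext]
structure Hom (c d : ClockCtx) : Type where
  /-- the map of clocks -/
  fn : Fin c.card → Fin d.card
  time_le : ∀ i, d.time (fn i) ≤ c.time i
  map_clk : fn c.clk = d.clk

instance : Category ClockCtx where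
  Hom := Hom
  id c := ⟨id, fun _ => le_rfl, rfl⟩
  comp f g := ⟨g.fn ∘ f.fn, fun i => (g.time_le _).trans (f.time_le i), by
    simp [f.map_clk, g.map_clk]⟩

@[ext]
theorem hom_ext {c d : ClockCtx} {f g : c ⟶ d} (h : f.fn = g.fn) : f = g := Hom.ext h

@[simp] theorem id_fn (c : ClockCtx) : Hom.fn (𝟙 c) = id := rfl
@[simp] theorem comp_fn {c d e : ClockCtx} (f : c ⟶ d) (g : d ⟶ e) :
    Hom.fn (f ≫ g) = g.fn ∘ f.fn := rfl

/-- The time remaining on the distinguished clock. -/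
def now (c : ClockCtx) : ℕ := c.time c.clk

theorem now_le {c d : ClockCtx} (f : c ⟶ d) : d.now ≤ c.now := by
  have := f.time_le c.clk
  rwa [f.map_clk] at this

/-- The context after one tick of the distinguished clock. -/
def tick (c : ClockCtx) (_ : 0 < c.now) : ClockCtx where
  card := c.card
  time := Function.update c.time c.clk (c.now - 1)
  clk := c.clk

theorem now_tick (c : ClockCtx) (h : 0 < c.now) : (c.tick h).now = c.now - 1 := by
  simp [tick, now]

theorem now_tick_lt (c : ClockCtx) (h : 0 < c.now) : (c.tick h).now < c.now := by
  rw [now_tick]; omega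

/-- The morphism along which data available now is transported past a tick. -/
def toTick (c : ClockCtx) (h : 0 < c.now) : c ⟶ c.tick h where
  fn := id
  time_le i := by
    by_cases hi : i = c.clk
    · subst hi; simp [tick, now]
    · simp [tick, hi]
  map_clk := rfl

theorem tick_time_le {c d : ClockCtx} (f : c ⟶ d) (i : Fin c.card) :
    Function.update d.time d.clk (d.now - 1) (f.fn i) ≤
      Function.update c.time c.clk (c.now - 1) i := by
  have h1 := f.time_le i
  have h2 := now_le f
  by_cases hi : i = c.clk
  · subst hi
    rw [f.map_clk, Function.update_self, Function.update_self]
    omega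
  · rw [Function.update_of_ne hi]
    by_cases hj : f.fn i = d.clk
    · rw [hj] at h1 ⊢
      rw [Function.update_self]
      exact (Nat.sub_le _ _).trans h1
    · rwa [Function.update_of_ne hj]

/-- Ticking is functorial. -/
def tickMap {c d : ClockCtx} (f : c ⟶ d) (hc : 0 < c.now) (hd : 0 < d.now) :
    c.tick hc ⟶ d.tick hd where
  fn := f.fn
  time_le := tick_time_le f
  map_clk := f.map_clk

end ClockCtx

open ClockCtx

/-- Types in the context of a clock `κ`. -/
abbrev Psh := ClockCtx ⥤ Type u

/-- The later modality on the distinguished clock: trivial if no time is left, and otherwise the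
value after one tick. -/
def later (X : Psh.{u}) : Psh.{u} where
  obj c := (h : 0 < c.now) → X.obj (c.tick h)
  map {c d} f := ↾fun x h => X.map (tickMap f (h.trans_le (now_le f)) h) (x _)
  map_id c := by
    apply ConcreteCategory.hom_ext
    intro x; funext h
    exact ConcreteCategory.congr_hom (X.map_id (c.tick h)) _
  map_comp {c d e} f g := by
    apply ConcreteCategory.hom_ext
    intro x; funext h
    exact ConcreteCategory.congr_hom
      (X.map_comp (tickMap f ((h.trans_le (now_le g)).trans_le (now_le f)) (h.trans_le (now_le g)))
        (tickMap g (h.trans_le (now_le g)) h)) _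

/-- The guarded delay type: the solution of `Delay X ≅ X + later (Delay X)`. -/
inductive Delay (X : Psh.{u}) : ClockCtx → Type u
  | now {c : ClockCtx} (x : X.obj c) : Delay X c
  | step {c : ClockCtx} (d : (h : 0 < c.now) → Delay X (c.tick h)) : Delay X c

namespace Delay

variable {X Y Z : Psh.{u}}

/-- Transport along morphisms of clock contexts. -/
def restrict {c : ClockCtx} : Delay X c → ∀ {d : ClockCtx}, (c ⟶ d) → Delay X d
  | now x, _, f => now (X.map f x)
  | step e, _, f => step fun h =>
      (e (h.trans_le (now_le f))).restrict (tickMap f (h.trans_le (now_le f)) h)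

theorem restrict_id {c : ClockCtx} (x : Delay X c) : x.restrict (𝟙 c) = x := by
  induction x with
  | now x => simp [restrict]
  | step e ih => exact congrArg step (funext fun h => ih h)

theorem restrict_comp {c : ClockCtx} (x : Delay X c) : ∀ {d e : ClockCtx} (f : c ⟶ d)
    (g : d ⟶ e), x.restrict (f ≫ g) = (x.restrict f).restrict g := by
  induction x with
  | now x => intros; simp [restrict]
  | step e ih =>
    intro d e' f g
    exact congrArg step (funext fun h => ih _ (tickMap f _ (h.trans_le (now_le g)))
      (tickMap g _ h))

/-- The presheaf of delayed elements of `X`. -/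
def psh (X : Psh.{u}) : Psh.{u} where
  obj c := Delay X c
  map f := ↾fun x => x.restrict f
  map_id c := by ext x; exact restrict_id x
  map_comp f g := by ext x; exact restrict_comp x f g

/-- Functoriality of the guarded delay type. -/
def map (φ : X ⟶ Y) {c : ClockCtx} : Delay X c → Delay Y c
  | now x => now (φ.app c x)
  | step e => step fun h => (e h).map φ

/-- The multiplication of the guarded delay monad. -/
def join {c : ClockCtx} : Delay (psh X) c → Delay X c
  | now x => x
  | step e => step fun h => (e h).join

theorem map_restrict (φ : X ⟶ Y) {c : ClockCtx} (x : Delay X c) : ∀ {d : ClockCtx} (f : c ⟶ d),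
    (x.restrict f).map φ = (x.map φ).restrict f := by
  induction x with
  | now x =>
    intro d f
    exact congrArg now (NatTrans.naturality_apply φ f x)
  | step e ih => intro d f; exact congrArg step (funext fun h => ih _ _)

theorem join_restrict {c : ClockCtx} (x : Delay (psh X) c) : ∀ {d : ClockCtx} (f : c ⟶ d),
    (x.restrict f).join = x.join.restrict f := by
  induction x with
  | now x => intro d f; rfl
  | step e ih => intro d f; exact congrArg step (funext fun h => ih _ _)

theorem map_id {c : ClockCtx} (x : Delay X c) : x.map (𝟙 X) = x := by
  induction x with
  | now x => rfl
  | step e ih => exact congrArg step (funext ih)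

theorem map_comp (φ : X ⟶ Y) (ψ : Y ⟶ Z) {c : ClockCtx} (x : Delay X c) :
    x.map (φ ≫ ψ) = (x.map φ).map ψ := by
  induction x with
  | now x => rfl
  | step e ih => exact congrArg step (funext ih)

/-- The guarded delay functor on morphisms of presheaves. -/
def pshMap (φ : X ⟶ Y) : psh X ⟶ psh Y where
  app c := ↾fun x => map φ x
  naturality c d f := by ext x; exact map_restrict φ x f

/-- The unit of the guarded delay monad. -/
def pshNow (X : Psh.{u}) : X ⟶ psh X where
  app c := ↾fun x => now x
  naturality c d f := by ext x; rfl

/-- The delay algebra structure on `psh X`. -/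
def pshStep (X : Psh.{u}) : later (psh X) ⟶ psh X where
  app c := ↾fun x => step x
  naturality c d f := by ext x; rfl

/-- The multiplication of the guarded delay monad, as a morphism of presheaves. -/
def pshJoin (X : Psh.{u}) : psh (psh X) ⟶ psh X where
  app c := ↾fun x => join x
  naturality c d f := by ext x; exact join_restrict x f

theorem join_map (φ : X ⟶ Y) {c : ClockCtx} (x : Delay (psh X) c) :
    (x.map (pshMap φ)).join = x.join.map φ := by
  induction x with
  | now x => rfl
  | step e ih => exact congrArg step (funext ih)

theorem join_assoc {c : ClockCtx} (x : Delay (psh (psh X)) c) :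
    (x.map (pshJoin X)).join = x.join.join := by
  induction x with
  | now x => rfl
  | step e ih => exact congrArg step (funext ih)

theorem join_map_now {c : ClockCtx} (x : Delay X c) : (x.map (pshNow X)).join = x := by
  induction x with
  | now x => rfl
  | step e ih => exact congrArg step (funext ih)

end Delay

/-- The guarded delay monad. -/
def guardedDelayMonad : CategoryTheory.Monad Psh.{u} where
  obj X := Delay.psh X
  map φ := Delay.pshMap φ
  map_id X := by ext c x; exact Delay.map_id x
  map_comp φ ψ := by ext c x; exact Delay.map_comp φ ψ x
  η := { app := Delay.pshNow, naturality := fun X Y φ => rfl }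
  μ := { app := Delay.pshJoin, naturality := fun X Y φ => by ext c x; exact Delay.join_map φ x }
  assoc X := by ext c x; exact Delay.join_assoc x
  left_unit X := rfl
  right_unit X := by ext c x; exact Delay.join_map_now x

/-- A monad on sets acts pointwise on presheaves. For the free model monad of an algebraic theory
this is the free model monad of that theory in the category of presheaves, since terms and
quotients of presheaves are computed pointwise. -/
def pointwiseMonad (T : CategoryTheory.Monad (Type u)) : CategoryTheory.Monad Psh.{u} where
  toFunctor := (Functor.whiskeringRight ClockCtx (Type u) (Type u)).obj T.toFunctor
  η := { app := fun X => { app := fun c => T.η.app (X.obj c)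
                           naturality := fun _ _ f => T.η.naturality (X.map f) }
         naturality := fun _ _ φ => by ext c : 2; exact T.η.naturality (φ.app c) }
  μ := { app := fun X => { app := fun c => T.μ.app (X.obj c)
                           naturality := fun _ _ f => T.μ.naturality (X.map f) }
         naturality := fun _ _ φ => by ext c : 2; exact T.μ.naturality (φ.app c) }
  assoc X := by ext c : 2; exact T.assoc _
  left_unit X := by ext c : 2; exact T.left_unit _
  right_unit X := by ext c : 2; exact T.right_unit _

/-! ## Sequential lifting of operations -/

namespace Delay

variable {X : Psh.{u}}

open Classical in
/-- The sequential lifting of an `n`-ary operation `f` on `X` to delayed elements: if all arguments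
have the form `now x`, apply `f`; otherwise run one step of the first argument that is not of this
form, leaving the others unchanged (transported past the tick), and recurse. -/
noncomputable def seqLift {n : ℕ} (f : ∀ c : ClockCtx, (Fin n → X.obj c) → X.obj c)
    (c : ClockCtx) (x : Fin n → Delay X c) : Delay X c :=
  if h : ∃ i, ∃ e, x i = step e then
    step fun ht => seqLift f (c.tick ht)
      (Function.update (fun j => (x j).restrict (c.toTick ht)) (Fin.find _ h)
        ((Fin.find_spec h).choose ht))
  else
    now (f c fun i => ((show ∃ y, x i = now y by
      rcases hx : x i with y | e
      · exact ⟨y, rfl⟩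
      · exact (h ⟨i, e, hx⟩).elim)).choose)
termination_by c.now
decreasing_by exact c.now_tick_lt ht

theorem seqLift_now {n : ℕ} (f : ∀ c : ClockCtx, (Fin n → X.obj c) → X.obj c)
    (c : ClockCtx) (x : Fin n → X.obj c) :
    seqLift f c (fun i => now (x i)) = now (f c x) := by
  rw [seqLift, dif_neg (by simp)]
  congr 2
  funext i
  generalize_proofs p
  exact (now.inj p.choose_spec).symm

theorem seqLift_step {n : ℕ} (f : ∀ c : ClockCtx, (Fin n → X.obj c) → X.obj c)
    (c : ClockCtx) (x : Fin n → Delay X c) (i : Fin n)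
    (e : (h : 0 < c.now) → Delay X (c.tick h)) (hi : x i = step e)
    (hlt : ∀ j < i, ∃ y, x j = now y) :
    seqLift f c x = step fun h => seqLift f (c.tick h)
      (Function.update (fun j => (x j).restrict (c.toTick h)) i (e h)) := by
  have h : ∃ i, ∃ e, x i = step e := ⟨i, e, hi⟩
  rw [seqLift, dif_pos h]
  generalize_proofs q
  have hki : @Fin.find n (fun k => ∃ e, x k = step e) (fun _ => Classical.propDecidable _) h = i := by
    classical
    refine (Fin.find_eq_iff h).2 ⟨⟨e, hi⟩, ?_⟩
    rintro j hj ⟨e', he'⟩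
    obtain ⟨y, hy⟩ := hlt j hj
    rw [hy] at he'; cases he'
  generalize @Fin.find n (fun k => ∃ e, x k = step e) (fun _ => Classical.propDecidable _) h = k
    at hki q
  subst hki
  have : q.choose = e := step.inj (q.choose_spec.symm.trans hi)
  rw [this]

end Delay

/-- If a monad `T` is presented by the theory `A`, that is, isomorphic to its free model monad, then
every set of the form `T X` carries the operations of `A`. -/
noncomputable def presentedOp {A : AlgTheory.{u}} {T : CategoryTheory.Monad (Type u)}
    (e : A.monad ≅ T) {X : Type u} {n : ℕ} (σ : A.Op n) (x : Fin n → T.obj X) : T.obj X :=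
  e.hom.app X (AlgTheory.FreeModel.op σ fun i => e.inv.app X (x i))

/-- A distributive law of a monad `T` presented by `A` over the guarded delay monad is given by
sequential lifting if it sends the operations on `T (Delay X)` to the sequential liftings of the
operations on `T X`. -/
def IsSequential {A : AlgTheory.{u}} {T : CategoryTheory.Monad (Type u)} (e : A.monad ≅ T)
    (ζ : DistributiveLaw (pointwiseMonad T) guardedDelayMonad.{u}) : Prop :=
  ∀ (X : Psh.{u}) (c : ClockCtx) (n : ℕ) (σ : A.Op n) (t : Fin n → T.obj (Delay X c)),
    (ζ.nat.app X).app c (presentedOp e σ t) =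
      Delay.seqLift (X := X ⋙ T.toFunctor) (fun _ x => presentedOp e σ x) c
        fun i => (ζ.nat.app X).app c (t i)

/-! ## The coinductive delay monad -/

/-- The coinductive delay monad: `Computation X` is the final coalgebra of `Y ↦ X + Y`. -/
def delayMonad : CategoryTheory.Monad (Type u) := ofTypeMonad Computation

/-- A set, as a clock-irrelevant type in the context of a clock. -/
abbrev const (X : Type u) : Psh.{u} := (Functor.const ClockCtx).obj X

/-- Evaluation of an element of the coinductive delay type at the distinguished clock. -/
def ev {X : Type u} (c : ClockCtx) (x : Computation X) : Delay (const X) c :=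
  match x.destruct with
  | .inl a => .now a
  | .inr y => .step fun h => ev (c.tick h) y
termination_by c.now
decreasing_by exact c.now_tick_lt h

/-- The law `ξ` for the coinductive delay monad is induced by the law `ζ` for the guarded one: up
to the identification of `D X` with the families of elements of `Delay (const X)` over all clock
contexts, it is the composite `T (∀ κ, D^κ X) ⟶ ∀ κ, T (D^κ X) ⟶ ∀ κ, D^κ (T X)`. -/
def IsInducedBy {T : CategoryTheory.Monad (Type u)} (ξ : DistributiveLaw T delayMonad.{u})
    (ζ : DistributiveLaw (pointwiseMonad T) guardedDelayMonad.{u}) : Prop :=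
  ∀ (X : Type u) (t : T.obj (Computation X)) (c : ClockCtx),
    ev c (ξ.nat.app X t) =
      (guardedDelayMonad.map (Functor.constComp ClockCtx X T.toFunctor).hom).app c
        ((ζ.nat.app (const X)).app c (T.map (↾fun x => ev c x) t))

/-! ## Trees, lists and multisets -/

/-- A constant and a binary operation. -/
inductive MonoidOp : ℕ → Type u
  | one : MonoidOp 0
  | mul : MonoidOp 2

/-- The constant, as a term. -/
def oneTm {X : Type v} : Term MonoidOp.{u} X := .op .one ![]

/-- The binary operation on terms. -/
def mulTm {X : Type v} (s t : Term MonoidOp.{u} X) : Term MonoidOp.{u} X := .op .mul ![s, t]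

/-- The two unit laws, in one variable. -/
def unitEqns : Set (Term MonoidOp.{u} (Fin 1) × Term MonoidOp.{u} (Fin 1)) :=
  {(mulTm oneTm (.var 0), .var 0), (mulTm (.var 0) oneTm, .var 0)}

/-- Associativity, in three variables. -/
def assocEqn : Term MonoidOp.{u} (Fin 3) × Term MonoidOp.{u} (Fin 3) :=
  (mulTm (mulTm (.var 0) (.var 1)) (.var 2), mulTm (.var 0) (mulTm (.var 1) (.var 2)))

/-- Commutativity, in two variables. -/
def commEqn : Term MonoidOp.{u} (Fin 2) × Term MonoidOp.{u} (Fin 2) :=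
  (mulTm (.var 0) (.var 1), mulTm (.var 1) (.var 0))

/-- The theory of magmas with a two-sided unit. -/
def magmaTheory : AlgTheory.{u} where
  Op := MonoidOp
  Eqn
    | 1 => unitEqns
    | _ => ∅

/-- The theory of monoids. -/
def monoidTheory : AlgTheory.{u} where
  Op := MonoidOp
  Eqn
    | 1 => unitEqns
    | 3 => {assocEqn}
    | _ => ∅

/-- The theory of commutative monoids. -/
def commMonoidTheory : AlgTheory.{u} where
  Op := MonoidOp
  Eqn
    | 1 => unitEqns
    | 2 => {commEqn}
    | 3 => {assocEqn}
    | _ => ∅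

/-- Binary trees with labels in `X` at the leaves: either the empty tree or a nonempty binary tree
(the latter are the elements of the free magma). -/
def BinTree (X : Type u) : Type u := WithOne (FreeMagma X)

/-- Grafting of trees, where empty subtrees are pruned. -/
def BinTree.bind {X Y : Type u} (t : BinTree X) (f : X → BinTree Y) : BinTree Y :=
  WithOne.lift (β := WithOne (FreeMagma Y)) (FreeMagma.lift f) t

instance : _root_.Monad BinTree.{u} where
  pure x := ((FreeMagma.of x : FreeMagma _) : WithOne (FreeMagma _))
  bind := BinTree.bind

theorem BinTree.bind_hom {X Y Z : Type u} (t : BinTree X) (f : X → BinTree Y)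
    (g : WithOne (FreeMagma Y) →* WithOne (FreeMagma Z)) :
    g (t.bind f) = t.bind fun x => g (f x) := by
  induction t using WithOne.recOneCoe with
  | one => exact map_one g
  | coe m =>
    change g (FreeMagma.lift (β := WithOne (FreeMagma Y)) f m) =
      FreeMagma.lift (β := WithOne (FreeMagma Z)) (fun x => g (f x)) m
    induction m with
    | ih1 x => rfl
    | ih2 a b iha ihb => rw [map_mul, map_mul, map_mul, iha, ihb]

instance : LawfulMonad BinTree.{u} := LawfulMonad.mk'
  (id_map := by
    intro α t
    induction t using WithOne.recOneCoe with
    | one => rfl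
    | coe m =>
      change FreeMagma.lift (β := WithOne (FreeMagma α))
        (fun x => ((FreeMagma.of x : FreeMagma α) : WithOne (FreeMagma α))) m = (m : WithOne _)
      induction m with
      | ih1 x => rfl
      | ih2 a b iha ihb => rw [map_mul, iha, ihb, WithOne.coe_mul])
  (pure_bind := by
    intro α β x f
    rfl)
  (bind_assoc := by
    intro α β γ t f g
    exact BinTree.bind_hom t f (WithOne.lift (β := WithOne (FreeMagma γ)) (FreeMagma.lift g)))

end GuardedDelay

/-! # Sequential lifting as a distributive law over the delay monads

The whole proof rests on one observation: an element of the guarded delay type at a context `c` is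
a number of steps together with, if there is time for that many steps, a value available then
(`Delay.exists_eq_delayed`), and in this description the sequential lifting of an operation adds up
the numbers of steps of its arguments and applies the operation to the values
(`Delay.seqLift_delayed`). So a term `t`, interpreted by sequential lifting, takes as many steps as
all occurrences of its variables together (`Delay.eval_seqLift`). The two sides of a balanced
equation therefore take equally many steps, and if there is time for them, the values agree because
the equation holds for the original operations. Hence `Delay (T X)` is again a model
(`Delay.isModel_seqLift`).

Since `T` is the free model monad, there is a unique family of homomorphisms `seqLaw` from
`T (Delay X)` to this model that extends the map `Delay X → Delay (T X)` given by the unit of `T`.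
That is the law `ζ`, and its uniqueness. Its axioms are identities between homomorphisms, which are
checked on generators; what remains to be shown is that the maps involved are homomorphisms for the
sequential liftings. The only case with content is the multiplication of the delay monad
(`Delay.join_seqLift`): it holds because steps may be taken from the arguments in any order
(`Delay.seqLift_step_any`).

For the coinductive delay monad, the evaluations `ev c` are jointly injective, and every compatible
family of elements of the guarded delay types comes from a computation, whose state after `m` steps
can be read off at a context with a single clock with time `m` (`exists_ev_eq`). So the family
`c ↦ ζ (T (ev c) t)` defines `ξ t`, and the axioms for `ξ` follow from those for `ζ` after applying
`ev c`, which is a morphism of monads (`ev_map`, `ev_bind_id`).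

Finally, the monads of trees, lists and multisets are the free model monads of their theories, as
these sets are the free unital magmas, monoids and commutative monoids (`nonempty_monad_iso`).
-/

namespace GuardedDelay

open ClockCtx

/-! ### Sequential lifting and the structure of the guarded delay monad -/

namespace Delay

variable {X Y : Psh.{u}}

theorem all_now_or_first_step {c : ClockCtx} {n : ℕ} (x : Fin n → Delay X c) :
    (∃ y : Fin n → X.obj c, x = fun i => now (y i)) ∨
      ∃ i e, x i = step e ∧ ∀ j < i, ∃ y, x j = now y := by
  classical
  by_cases h : ∃ i, ∃ e, x i = step e
  · refine .inr ⟨Fin.find _ h, _, (Fin.find_spec h).choose_spec, fun j hj => ?_⟩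
    have := Fin.find_min h hj
    rcases hx : x j with y | e
    · exact ⟨y, rfl⟩
    · exact (this ⟨e, hx⟩).elim
  · refine .inl ?_
    have : ∀ i, ∃ y, x i = now y := fun i => by
      rcases hx : x i with y | e
      · exact ⟨y, rfl⟩
      · exact (h ⟨i, e, hx⟩).elim
    choose y hy using this
    exact ⟨y, funext hy⟩

theorem restrict_toTick_comm {c d : ClockCtx} (g : c ⟶ d) (hc : 0 < c.now) (hd : 0 < d.now)
    (x : Delay X c) :
    (x.restrict (c.toTick hc)).restrict (tickMap g hc hd) =
      (x.restrict g).restrict (d.toTick hd) := by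
  rw [← restrict_comp, ← restrict_comp]
  rfl

/-- Sequential lifting preserves naturality. -/
theorem seqLift_restrict {n : ℕ} (f : ∀ c : ClockCtx, (Fin n → X.obj c) → X.obj c)
    (hf : ∀ {c d : ClockCtx} (g : c ⟶ d) (x : Fin n → X.obj c),
      X.map g (f c x) = f d fun i => X.map g (x i))
    {c d : ClockCtx} (g : c ⟶ d) (x : Fin n → Delay X c) :
    (seqLift f c x).restrict g = seqLift f d fun i => (x i).restrict g := by
  obtain ⟨y, rfl⟩ | ⟨i, e, hi, hlt⟩ := all_now_or_first_step x
  · rw [seqLift_now]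
    simp only [restrict]
    rw [seqLift_now, hf]
  · rw [seqLift_step f c x i e hi hlt, seqLift_step f d _ i
      (fun h => (e (h.trans_le (now_le g))).restrict (tickMap g (h.trans_le (now_le g)) h))
      (by simp only [hi, restrict])
      (fun j hj => by obtain ⟨y, hy⟩ := hlt j hj; exact ⟨X.map g y, by simp only [hy, restrict]⟩)]
    refine congrArg step (funext fun h => ?_)
    have hc : 0 < c.now := h.trans_le (now_le g)
    rw [seqLift_restrict f hf (tickMap g hc h)]
    congr 1
    funext j
    by_cases hj : j = i
    · subst hj; simp only [Function.update_self]
    · simp only [Function.update_of_ne hj, restrict_toTick_comm]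
termination_by c.now
decreasing_by exact c.now_tick_lt hc

/-- Sequential lifting takes homomorphisms to homomorphisms. -/
theorem seqLift_map {n : ℕ} (f : ∀ c : ClockCtx, (Fin n → X.obj c) → X.obj c)
    (g : ∀ c : ClockCtx, (Fin n → Y.obj c) → Y.obj c) (φ : X ⟶ Y)
    (hφ : ∀ (c : ClockCtx) (x : Fin n → X.obj c), φ.app c (f c x) = g c fun i => φ.app c (x i))
    {c : ClockCtx} (x : Fin n → Delay X c) :
    (seqLift f c x).map φ = seqLift g c fun i => (x i).map φ := by
  obtain ⟨y, rfl⟩ | ⟨i, e, hi, hlt⟩ := all_now_or_first_step x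
  · rw [seqLift_now]
    simp only [map]
    rw [seqLift_now, hφ]
  · rw [seqLift_step f c x i e hi hlt, seqLift_step g c _ i (fun h => (e h).map φ)
      (by simp only [hi, map])
      (fun j hj => by obtain ⟨y, hy⟩ := hlt j hj; exact ⟨φ.app c y, by simp only [hy, map]⟩)]
    refine congrArg step (funext fun h => ?_)
    rw [seqLift_map f g φ hφ]
    congr 1
    funext j
    by_cases hj : j = i
    · subst hj; simp only [Function.update_self]
    · simp only [Function.update_of_ne hj, map_restrict]
termination_by c.now
decreasing_by exact c.now_tick_lt h

/-- A step may be taken from any argument of a sequential lifting, not only from the first one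
that is ready to take it. -/
theorem seqLift_step_any {n : ℕ} (f : ∀ c : ClockCtx, (Fin n → X.obj c) → X.obj c)
    (c : ClockCtx) (x : Fin n → Delay X c) (i : Fin n)
    (e : (h : 0 < c.now) → Delay X (c.tick h)) (hi : x i = step e) :
    seqLift f c x = step fun h => seqLift f (c.tick h)
      (Function.update (fun j => (x j).restrict (c.toTick h)) i (e h)) := by
  obtain ⟨y, rfl⟩ | ⟨k, e', hk, hlt⟩ := all_now_or_first_step x
  · cases hi
  · by_cases hik : i = k
    · subst hik; exact seqLift_step f c x i e hi hlt
    · -- The first available step is that of `k`. After one tick, both sides can take the step of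
      -- the other of the two arguments, and then agree.
      rw [seqLift_step f c x k e' hk hlt]
      refine congrArg step (funext fun h => ?_)
      rw [seqLift_step_any f (c.tick h) _ i
          (fun h' => (e (h'.trans_le (now_le (c.toTick h)))).restrict (tickMap (c.toTick h) h h'))
          (by rw [Function.update_of_ne hik, hi]; rfl),
        seqLift_step_any f (c.tick h) _ k
          (fun h' => (e' (h'.trans_le (now_le (c.toTick h)))).restrict (tickMap (c.toTick h) h h'))
          (by rw [Function.update_of_ne (Ne.symm hik), hk]; rfl)]
      refine congrArg step (funext fun h' => ?_)
      congr 1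
      funext j
      by_cases hj : j = i
      · subst hj
        simp only [Function.update_self, Function.update_of_ne hik]
        rfl
      · by_cases hj' : j = k
        · subst hj'
          simp only [Function.update_self, Function.update_of_ne hj]
          rfl
        · simp only [Function.update_of_ne hj, Function.update_of_ne hj']
termination_by c.now
decreasing_by all_goals exact c.now_tick_lt h

/-- Sequential lifting commutes with the multiplication of the guarded delay monad: since steps may
be taken in any order, it does not matter whether the outer steps of all arguments are taken
first. -/
theorem join_seqLift {n : ℕ} (f : ∀ c : ClockCtx, (Fin n → X.obj c) → X.obj c)
    (F : ∀ c : ClockCtx, (Fin n → (psh X).obj c) → (psh X).obj c)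
    (hF : ∀ (c : ClockCtx) (y : Fin n → Delay X c), F c y = seqLift f c y)
    {c : ClockCtx} (x : Fin n → Delay (psh X) c) :
    (seqLift F c x).join = seqLift f c fun i => (x i).join := by
  obtain ⟨y, rfl⟩ | ⟨i, e, hi, hlt⟩ := all_now_or_first_step x
  · rw [seqLift_now]
    exact hF c y
  · rw [seqLift_step F c x i e hi hlt, seqLift_step_any f c _ i (fun h => (e h).join)
      (by simp only [hi, join])]
    refine congrArg step (funext fun h => ?_)
    rw [join_seqLift f F hF]
    congr 1
    funext j
    by_cases hj : j = i
    · subst hj; simp only [Function.update_self]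
    · simp only [Function.update_of_ne hj, join_restrict]
termination_by c.now
decreasing_by exact c.now_tick_lt h

end Delay

/-! ### Counting steps -/

namespace ClockCtx

/-- The context after `k` ticks of the distinguished clock. The subtraction is truncated, so this is
only meaningful for `k ≤ c.now`. -/
def sub (c : ClockCtx) (k : ℕ) : ClockCtx where
  card := c.card
  time := Function.update c.time c.clk (c.now - k)
  clk := c.clk

theorem sub_time_le {c d : ClockCtx} (g : c ⟶ d) {k l : ℕ} (h : d.now - l ≤ c.now - k)
    (i : Fin c.card) :
    Function.update d.time d.clk (d.now - l) (g.fn i) ≤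
      Function.update c.time c.clk (c.now - k) i := by
  have h1 := g.time_le i
  by_cases hi : i = c.clk
  · subst hi
    rwa [g.map_clk, Function.update_self, Function.update_self]
  · rw [Function.update_of_ne hi]
    by_cases hj : g.fn i = d.clk
    · rw [hj] at h1 ⊢
      rw [Function.update_self]
      exact (Nat.sub_le _ _).trans h1
    · rwa [Function.update_of_ne hj]

/-- A morphism of contexts remains one after letting time pass, as long as the time remaining in
the target does not exceed that in the source. -/
def subMap {c d : ClockCtx} (g : c ⟶ d) {k l : ℕ} (h : d.now - l ≤ c.now - k) :
    c.sub k ⟶ d.sub l where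
  fn := g.fn
  time_le := sub_time_le g h
  map_clk := g.map_clk

theorem sub_zero_time (c : ClockCtx) : (c.sub 0).time = c.time :=
  Function.update_eq_self_iff.2 (Nat.sub_zero _)

theorem tick_sub_time (c : ClockCtx) (h : 0 < c.now) (k : ℕ) :
    ((c.tick h).sub k).time = (c.sub (k + 1)).time :=
  (Function.update_idem _ _ _).trans
    (congrArg (Function.update c.time c.clk) (by rw [now_tick]; omega))

/-- No time has passed after zero ticks. -/
def subZero (c : ClockCtx) : c.sub 0 ⟶ c where
  fn := id
  time_le i := (congrFun c.sub_zero_time i).ge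
  map_clk := rfl

/-- The inverse of `subZero`. -/
def toSubZero (c : ClockCtx) : c ⟶ c.sub 0 where
  fn := id
  time_le i := (congrFun c.sub_zero_time i).le
  map_clk := rfl

/-- The time after one tick and `k` further ticks is that after `k + 1` ticks. -/
def tickSub (c : ClockCtx) (h : 0 < c.now) (k : ℕ) : (c.tick h).sub k ⟶ c.sub (k + 1) where
  fn := id
  time_le i := (congrFun (c.tick_sub_time h k) i).ge
  map_clk := rfl

end ClockCtx

namespace Delay

variable {X : Psh.{u}}

/-- The value `v`, available after `k` steps. A value is only needed if there is time for `k`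
steps. -/
def delayed : (c : ClockCtx) → (k : ℕ) → (k ≤ c.now → X.obj (c.sub k)) → Delay X c
  | c, 0, v => now (X.map (subZero c) (v (Nat.zero_le _)))
  | c, k + 1, v => step fun h => delayed (c.tick h) k fun h' =>
      X.map (subMap (c.toTick h) (by rw [now_tick]; omega))
        (v (by rw [now_tick] at h'; omega))

theorem delayed_eq_now {c : ClockCtx} {k : ℕ} (hk : k = 0) (v : k ≤ c.now → X.obj (c.sub k)) :
    delayed c k v = now (X.map (subMap (𝟙 c) (by omega) ≫ subZero c) (v (by omega))) := by
  subst hk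
  rfl

theorem delayed_eq_step {c : ClockCtx} {k l : ℕ} (hk : k = l + 1)
    (v : k ≤ c.now → X.obj (c.sub k)) :
    delayed c k v = step fun h => delayed (c.tick h) l fun h' =>
      X.map (subMap (c.toTick h) (by rw [now_tick]; omega))
        (v (by rw [now_tick] at h'; omega)) := by
  subst hk
  rfl

theorem restrict_delayed {c d : ClockCtx} (g : c ⟶ d) {k l : ℕ} (hk : l = k)
    (v : k ≤ c.now → X.obj (c.sub k)) :
    (delayed c k v).restrict g = delayed d l fun h =>
      X.map (subMap g (by have := now_le g; omega))
        (v (by have := now_le g; omega)) := by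
  subst hk
  induction l generalizing c d with
  | zero =>
    simp only [delayed, restrict]
    rw [← Functor.map_comp_apply, ← Functor.map_comp_apply]
    rfl
  | succ l ih =>
    simp only [delayed, restrict]
    refine congrArg step (funext fun h => ?_)
    rw [ih]
    congr 1
    funext h'
    rw [← Functor.map_comp_apply, ← Functor.map_comp_apply]
    rfl

/-- Every delayed element takes some number of steps, which may exceed the remaining time. -/
theorem exists_eq_delayed {c : ClockCtx} (x : Delay X c) :
    ∃ k v, x = delayed c k v := by
  induction x with
  | @now c x =>
    refine ⟨0, fun _ => X.map (toSubZero c) x, ?_⟩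
    simp only [delayed]
    rw [← Functor.map_comp_apply]
    exact congrArg now (X.map_id_apply c x).symm
  | @step c e ih =>
    by_cases h : 0 < c.now
    · obtain ⟨k, v, hv⟩ := ih h
      refine ⟨k + 1, fun h' => X.map (tickSub c h k) (v (by rw [now_tick]; omega)), ?_⟩
      refine congrArg step (funext fun _ => hv.trans ?_)
      congr 1
      funext h'
      rw [← Functor.map_comp_apply]
      exact (X.map_id_apply _ _).symm
    · exact ⟨1, fun h' => (h h').elim, congrArg step (funext fun h' => (h h').elim)⟩

theorem le_of_sum_eq {n : ℕ} {k : Fin n → ℕ} {m : ℕ} (hm : ∑ i, k i = m) (i : Fin n) : k i ≤ m :=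
  hm ▸ Finset.single_le_sum (fun _ _ => Nat.zero_le _) (Finset.mem_univ i)

/-- Sequential lifting adds up the numbers of steps of its arguments. -/
theorem seqLift_delayed {n : ℕ} (f : ∀ c : ClockCtx, (Fin n → X.obj c) → X.obj c)
    (hf : ∀ {c d : ClockCtx} (g : c ⟶ d) (x : Fin n → X.obj c),
      X.map g (f c x) = f d fun i => X.map g (x i))
    {m : ℕ} {c : ClockCtx} (k : Fin n → ℕ) (hm : ∑ i, k i = m)
    (v : ∀ i, k i ≤ c.now → X.obj (c.sub (k i))) :
    seqLift f c (fun i => delayed c (k i) (v i)) = delayed c m fun h => f _ fun i =>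
      X.map (subMap (𝟙 c) (by have := le_of_sum_eq hm i; omega))
        (v i ((le_of_sum_eq hm i).trans h)) := by
  induction m generalizing c k with
  | zero =>
    have hk : ∀ i, k i = 0 := fun i => Nat.le_zero.1 (le_of_sum_eq hm i)
    simp only [delayed_eq_now (hk _), seqLift_now, delayed, hf]
    congr 2
    funext i
    rw [← Functor.map_comp_apply]
  | succ m ih =>
    obtain ⟨i, hi⟩ : ∃ i, k i ≠ 0 := by
      by_contra! h
      simp [h] at hm
    obtain ⟨l, hl⟩ := Nat.exists_eq_succ_of_ne_zero hi
    rw [seqLift_step_any f c _ i _ (delayed_eq_step hl (v i))]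
    refine congrArg step (funext fun h => ?_)
    have hk' : ∀ j, k j ≤ Function.update k i l j + 1 := fun j => by
      by_cases hj : j = i
      · subst hj; rw [Function.update_self]; omega
      · rw [Function.update_of_ne hj]; omega
    have hm' : ∑ j, Function.update k i l j = m := by
      rw [Finset.sum_update_of_mem (Finset.mem_univ i)]
      rw [← Finset.add_sum_erase _ _ (Finset.mem_univ i), ← Finset.sdiff_singleton_eq_erase] at hm
      omega
    -- The arguments after the step of the `i`-th one, in a form that is uniform in the index.
    have key : Function.update
        (fun j => (delayed c (k j) (v j)).restrict (c.toTick h)) i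
          (delayed (c.tick h) l fun h' =>
            X.map (subMap (c.toTick h) (by rw [now_tick]; omega))
              (v i (by rw [now_tick] at h'; omega))) =
        fun j => delayed (c.tick h) (Function.update k i l j) fun h' =>
          X.map (subMap (c.toTick h) (by have := hk' j; rw [now_tick]; omega))
            (v j (by have := hk' j; rw [now_tick] at h'; omega)) := by
      funext j
      by_cases hj : j = i
      · subst hj
        rw [Function.update_self]
        have : Function.update k j l j = l := Function.update_self ..
        generalize_proofs
        generalize Function.update k j l j = l' at *
        subst this
        rfl
      · rw [Function.update_of_ne hj, restrict_delayed (c.toTick h)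
          (Function.update_of_ne hj l k : Function.update k i l j = k j)]
    rw [key, ih _ hm']
    congr 1
    funext h'
    rw [hf]
    congr 1
    funext j
    rw [← Functor.map_comp_apply, ← Functor.map_comp_apply]
    rfl

end Delay

namespace Term

variable {S : ℕ → Type u}

/-- The sum over all occurrences of variables in a term of given numbers. -/
theorem eval_sum_eq_sum_occ {n : ℕ} (t : Term S (Fin n)) (k : Fin n → ℕ) :
    t.eval (fun {_} _ x => ∑ i, x i) k = ∑ i, t.occ i * k i := by
  induction t with
  | var i => simp [eval, occ]
  | op σ t ih =>
    simp only [eval, occ, ih, Finset.sum_mul]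
    exact Finset.sum_comm

end Term

namespace Delay

variable {S : ℕ → Type u} {V : Type v} {X : Psh.{w}}

/-- The interpretation of a term under sequential lifting: the numbers of steps of all occurrences
of variables add up, and the value, if there is time to compute it, is that of the term for the
values of the variables. An assignment `ρ` at a later stage `K` is used instead of these values
because a variable that does not occur in the term need not have a value. -/
theorem eval_seqLift (I : ∀ {n : ℕ}, S n → ∀ c : ClockCtx, (Fin n → X.obj c) → X.obj c)
    (hI : ∀ {n : ℕ} (σ : S n) {c d : ClockCtx} (g : c ⟶ d) (x : Fin n → X.obj c),
      X.map g (I σ c x) = I σ d fun i => X.map g (x i))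
    {c : ClockCtx} (k : V → ℕ) (v : ∀ i, k i ≤ c.now → X.obj (c.sub (k i))) (t : Term S V)
    {m : ℕ} (hm : t.eval (fun {_} _ x => ∑ i, x i) k = m) :
    ∃ w, t.eval (fun {_} σ x => seqLift (I σ) c x) (fun i => delayed c (k i) (v i)) =
        delayed c m w ∧
      ∀ (K : ℕ) (hK : m ≤ K) (h : K ≤ c.now) (ρ : V → X.obj (c.sub K)),
        (∀ i (hi : k i ≤ K), ρ i = X.map (subMap (𝟙 c) (by omega)) (v i (hi.trans h))) →
        X.map (subMap (𝟙 c) (by omega)) (w (hK.trans h)) =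
          t.eval (fun {_} σ x => I σ (c.sub K) x) ρ := by
  induction t generalizing m with
  | var i => subst hm; exact ⟨v i, rfl, fun K hK h ρ hρ => (hρ i hK).symm⟩
  | op σ t ih =>
    choose w hw hw' using fun i => ih i rfl
    refine ⟨_, (congrArg (seqLift (I σ) c) (funext hw)).trans
      (seqLift_delayed (I σ) (hI σ) _ hm w), fun K hK h ρ hρ => ?_⟩
    refine (hI σ _ _).trans (congrArg (I σ (c.sub K)) (funext fun i => ?_))
    exact (X.map_comp_apply _ _ _).symm.trans (hw' i K ((le_of_sum_eq hm i).trans hK) h ρ hρ)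

/-- If all equations of a theory are balanced, then the sequential liftings of the operations of a
model satisfy them again: the numbers of steps on both sides agree. -/
theorem isModel_seqLift {A : AlgTheory.{u}} (hA : A.IsBalanced)
    (I : ∀ {n : ℕ}, A.Op n → ∀ c : ClockCtx, (Fin n → X.obj c) → X.obj c)
    (hI : ∀ {n : ℕ} (σ : A.Op n) {c d : ClockCtx} (g : c ⟶ d) (x : Fin n → X.obj c),
      X.map g (I σ c x) = I σ d fun i => X.map g (x i))
    (hM : ∀ c, A.IsModel (fun {_} σ x => I σ c x)) (c : ClockCtx) :
    A.IsModel (fun {_} σ (x : Fin _ → Delay X c) => seqLift (I σ) c x) := by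
  intro n s t h ρ
  choose k v hv using fun i => exists_eq_delayed (ρ i)
  obtain rfl : ρ = fun i => delayed c (k i) (v i) := funext hv
  obtain ⟨K, hs⟩ : ∃ K, s.eval (fun {_} _ x => ∑ i, x i) k = K := ⟨_, rfl⟩
  have ht : t.eval (fun {_} _ x => ∑ i, x i) k = K := by
    rw [← hs]
    simp only [Term.eval_sum_eq_sum_occ, hA n s t h]
  obtain ⟨a, ha, ha'⟩ := eval_seqLift I hI k v s hs
  obtain ⟨b, hb, hb'⟩ := eval_seqLift I hI k v t ht
  rw [ha, hb]
  congr 1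
  funext hK
  classical
  -- Variables that take more than `K` steps do not occur; the value of `s` replaces theirs.
  let θ : Fin n → X.obj (c.sub K) := fun i =>
    if hi : k i ≤ K then X.map (subMap (𝟙 c) (by omega)) (v i (hi.trans hK)) else a hK
  have hθ : ∀ i (hi : k i ≤ K), θ i = X.map (subMap (𝟙 c) (by omega)) (v i (hi.trans hK)) :=
    fun i hi => dif_pos hi
  have := (ha' K le_rfl hK θ hθ).trans ((hM _ n s t h θ).trans (hb' K le_rfl hK θ hθ).symm)
  have e : subMap (𝟙 c) (le_refl (c.now - K)) = 𝟙 (c.sub K) := rfl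
  rw [e] at this
  simpa only [Functor.map_id_apply] using this

end Delay

/-! ### Monads presented by a theory -/

namespace AlgTheory.FreeModel

variable {A : AlgTheory.{u}}

theorem lift_op {X : Type v} {Y : Type w} (I : ∀ {n : ℕ}, A.Op n → (Fin n → Y) → Y)
    (hI : A.IsModel I) (ρ : X → Y) {n : ℕ} (σ : A.Op n) (x : Fin n → A.FreeModel X) :
    lift I hI ρ (op σ x) = I σ fun i => lift I hI ρ (x i) :=
  congrArg (I σ) (funext fun i =>
    congrArg (lift I hI ρ) (Quotient.out_eq (s := A.setoid X) (x i)))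

/-- Renaming of variables. -/
noncomputable def map {X Y : Type u} (f : X → Y) : A.FreeModel X → A.FreeModel Y :=
  lift (fun {_} => op) isModel fun x => mk (.var (f x))

/-- Flattening of terms whose variables are terms. -/
noncomputable def join {X : Type u} : A.FreeModel (A.FreeModel X) → A.FreeModel X :=
  lift (fun {_} => op) isModel id

theorem map_op {X Y : Type u} (f : X → Y) {n : ℕ} (σ : A.Op n) (x : Fin n → A.FreeModel X) :
    map f (op σ x) = op σ fun i => map f (x i) :=
  lift_op _ _ _ _ _

theorem join_op (X : Type u) {n : ℕ} (σ : A.Op n) (x : Fin n → A.FreeModel (A.FreeModel X)) :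
    join (op σ x) = op σ fun i => join (x i) :=
  lift_op _ _ _ _ _

end AlgTheory.FreeModel

section Presented

variable {A : AlgTheory.{u}} {T : CategoryTheory.Monad (Type u)} (e : A.monad ≅ T)

/-- The bijection between the free model and `T X`. -/
def presentedEquiv (X : Type u) : A.FreeModel X ≃ T.obj X where
  toFun x := e.hom.app X x
  invFun x := e.inv.app X x
  left_inv x := ConcreteCategory.congr_hom (NatTrans.congr_app
    (congrArg MonadHom.toNatTrans e.hom_inv_id) X) x
  right_inv x := ConcreteCategory.congr_hom (NatTrans.congr_app
    (congrArg MonadHom.toNatTrans e.inv_hom_id) X) x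

theorem presentedOp_eq {X : Type u} {n : ℕ} (σ : A.Op n) (x : Fin n → T.obj X) :
    presentedOp e σ x = presentedEquiv e X (.op σ fun i => (presentedEquiv e X).symm (x i)) :=
  rfl

theorem presentedOp_presentedEquiv {X : Type u} {n : ℕ} (σ : A.Op n)
    (x : Fin n → A.FreeModel X) :
    presentedOp e σ (fun i => presentedEquiv e X (x i)) = presentedEquiv e X (.op σ x) := by
  simp only [presentedOp_eq, Equiv.symm_apply_apply]

theorem presentedEquiv_var {X : Type u} (x : X) :
    presentedEquiv e X (.mk (.var x)) = T.η.app X x :=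
  ConcreteCategory.congr_hom (e.hom.app_η X) x

theorem map_presentedEquiv {X Y : Type u} (f : X ⟶ Y) (x : A.FreeModel X) :
    T.map f (presentedEquiv e X x) = presentedEquiv e Y (.map f x) :=
  (ConcreteCategory.congr_hom (e.hom.naturality f) x).symm

theorem μ_presentedEquiv {X : Type u} (x : A.FreeModel (A.FreeModel X)) :
    T.μ.app X (presentedEquiv e _ (.map (presentedEquiv e X) x)) =
      presentedEquiv e X (.join x) :=
  (ConcreteCategory.congr_hom (e.hom.app_μ X) x).symm

/-- The elements of `T X` are generated by `X` under the operations. -/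
theorem presented_induction {X : Type u} {P : T.obj X → Prop} (η : ∀ x : X, P (T.η.app X x))
    (op : ∀ {n : ℕ} (σ : A.Op n) (x : Fin n → T.obj X), (∀ i, P (x i)) → P (presentedOp e σ x))
    (t : T.obj X) : P t := by
  obtain ⟨t, rfl⟩ := (presentedEquiv e X).surjective t
  induction t using AlgTheory.FreeModel.ind with
  | h t =>
    induction t with
    | var x => rw [presentedEquiv_var]; exact η x
    | op σ t ih =>
      rw [← AlgTheory.FreeModel.op_mk, ← presentedOp_presentedEquiv]
      exact op σ _ ih

theorem map_presentedOp {X Y : Type u} (f : X ⟶ Y) {n : ℕ} (σ : A.Op n) (x : Fin n → T.obj X) :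
    T.map f (presentedOp e σ x) = presentedOp e σ fun i => T.map f (x i) := by
  obtain ⟨y, rfl⟩ : ∃ y : Fin n → A.FreeModel X, x = fun i => presentedEquiv e X (y i) :=
    ⟨_, funext fun i => ((presentedEquiv e X).apply_symm_apply (x i)).symm⟩
  simp only [presentedOp_presentedEquiv, map_presentedEquiv, AlgTheory.FreeModel.map_op]

/-- Maps that are surjective on generators are surjective on free models. -/
theorem exists_presentedEquiv_map {X Y : Type u} (f : X → Y) (hf : f.Surjective)
    (y : T.obj Y) : ∃ x : A.FreeModel X, y = presentedEquiv e Y (.map f x) := by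
  induction y using presented_induction e with
  | η y =>
    obtain ⟨x, rfl⟩ := hf y
    exact ⟨.mk (.var x), (presentedEquiv_var e _).symm⟩
  | op σ y ih =>
    choose x hx using ih
    obtain rfl : y = _ := funext hx
    exact ⟨.op σ x, by rw [AlgTheory.FreeModel.map_op, presentedOp_presentedEquiv]⟩

theorem μ_presentedOp {X : Type u} {n : ℕ} (σ : A.Op n) (x : Fin n → T.obj (T.obj X)) :
    T.μ.app X (presentedOp e σ x) = presentedOp e σ fun i => T.μ.app X (x i) := by
  choose y hy using fun i =>
    exists_presentedEquiv_map e (presentedEquiv e X) (presentedEquiv e X).surjective (x i)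
  obtain rfl : x = _ := funext hy
  rw [presentedOp_presentedEquiv, ← AlgTheory.FreeModel.map_op, μ_presentedEquiv]
  simp only [μ_presentedEquiv, presentedOp_presentedEquiv, AlgTheory.FreeModel.join_op]

theorem isModel_presentedOp (X : Type u) :
    A.IsModel (fun {_} σ (x : Fin _ → T.obj X) => presentedOp e σ x) := by
  have key {n : ℕ} (ρ : Fin n → T.obj X) (t : Term A.Op (Fin n)) :
      t.eval (fun {_} σ x => presentedOp e σ x) ρ =
        presentedEquiv e X (t.eval (fun {_} => AlgTheory.FreeModel.op (A := A))
          fun i => (presentedEquiv e X).symm (ρ i)) := by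
    induction t with
    | var i => exact ((presentedEquiv e X).apply_symm_apply _).symm
    | op σ t ih => simp only [Term.eval, ih, presentedOp_presentedEquiv]
  intro n s t h ρ
  rw [key, key, AlgTheory.FreeModel.isModel n s t h]

/-- The homomorphism from the free model `T X` to a model that extends a map on generators. -/
noncomputable def presentedLift {X : Type u} {Y : Type w}
    (I : ∀ {n : ℕ}, A.Op n → (Fin n → Y) → Y) (hI : A.IsModel I) (ρ : X → Y) (t : T.obj X) : Y :=
  AlgTheory.FreeModel.lift I hI ρ ((presentedEquiv e X).symm t)

variable {X : Type u} {Y : Type w} (I : ∀ {n : ℕ}, A.Op n → (Fin n → Y) → Y) (hI : A.IsModel I)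
  (ρ : X → Y)

theorem presentedLift_η (x : X) : presentedLift e I hI ρ (T.η.app X x) = ρ x := by
  rw [presentedLift, ← presentedEquiv_var e, Equiv.symm_apply_apply]
  rfl

theorem presentedLift_op {n : ℕ} (σ : A.Op n) (x : Fin n → T.obj X) :
    presentedLift e I hI ρ (presentedOp e σ x) = I σ fun i => presentedLift e I hI ρ (x i) := by
  simp only [presentedLift, presentedOp_eq, Equiv.symm_apply_apply, AlgTheory.FreeModel.lift_op]

end Presented

/-! ### The sequential distributive law -/

theorem monad_map_η (T : CategoryTheory.Monad (Type u)) {X Y : Type u} (f : X ⟶ Y) (x : X) :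
    T.map f (T.η.app X x) = T.η.app Y (f x) :=
  (ConcreteCategory.congr_hom (T.η.naturality f) x).symm

theorem monad_μ_η (T : CategoryTheory.Monad (Type u)) {X : Type u} (x : T.obj X) :
    T.μ.app X (T.η.app _ x) = x :=
  ConcreteCategory.congr_hom (T.left_unit X) x

/-- The unit of the pointwise action of `T` on presheaves. -/
def pointwiseUnit (T : CategoryTheory.Monad (Type u)) (X : Psh.{u}) : X ⟶ X ⋙ T.toFunctor :=
  (pointwiseMonad T).η.app X

/-- The multiplication of the pointwise action of `T` on presheaves. -/
def pointwiseMult (T : CategoryTheory.Monad (Type u)) (X : Psh.{u}) :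
    (X ⋙ T.toFunctor) ⋙ T.toFunctor ⟶ X ⋙ T.toFunctor :=
  (pointwiseMonad T).μ.app X

section Law

variable {A : AlgTheory.{u}} (hA : A.IsBalanced) {T : CategoryTheory.Monad (Type u)}
  (e : A.monad ≅ T)

/-- The unique family of homomorphisms extending the functorial action of the guarded delay monad
on the unit of `T`, where the operations act on the target by sequential lifting. -/
noncomputable def seqLaw (X : Psh.{u}) (c : ClockCtx) :
    T.obj (Delay X c) → Delay (X ⋙ T.toFunctor) c :=
  presentedLift e
    (fun {_} σ => Delay.seqLift (X := X ⋙ T.toFunctor) (fun _ x => presentedOp e σ x) c)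
    (Delay.isModel_seqLift (X := X ⋙ T.toFunctor) hA (fun {_} σ _ x => presentedOp e σ x)
      (fun σ _ _ g x => map_presentedOp e (X.map g) σ x) (fun c => isModel_presentedOp e (X.obj c))
      c)
    (Delay.map (pointwiseUnit T X))

theorem seqLaw_η (X : Psh.{u}) (c : ClockCtx) (x : Delay X c) :
    seqLaw hA e X c (T.η.app _ x) = x.map (pointwiseUnit T X) :=
  presentedLift_η e _ _ _ x

theorem seqLaw_op (X : Psh.{u}) (c : ClockCtx) {n : ℕ} (σ : A.Op n)
    (x : Fin n → T.obj (Delay X c)) :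
    seqLaw hA e X c (presentedOp e σ x) =
      Delay.seqLift (X := X ⋙ T.toFunctor) (fun _ x => presentedOp e σ x) c
        fun i => seqLaw hA e X c (x i) :=
  presentedLift_op e _ _ _ σ x

theorem seqLaw_restrict (X : Psh.{u}) {c d : ClockCtx} (g : c ⟶ d) (t : T.obj (Delay X c)) :
    seqLaw hA e X d (T.map (↾fun x : Delay X c => x.restrict g) t) =
      (seqLaw hA e X c t).restrict g := by
  induction t using presented_induction e with
  | η x => rw [monad_map_η, seqLaw_η, seqLaw_η]; exact Delay.map_restrict _ x g
  | op σ x ih =>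
    rw [map_presentedOp, seqLaw_op, seqLaw_op, Delay.seqLift_restrict]
    · simp only [ih]
    · exact fun g x => map_presentedOp e (X.map g) σ x

theorem seqLaw_map {X Y : Psh.{u}} (φ : X ⟶ Y) (c : ClockCtx) (t : T.obj (Delay X c)) :
    seqLaw hA e Y c (T.map (↾fun x : Delay X c => x.map φ) t) =
      (seqLaw hA e X c t).map (Functor.whiskerRight φ T.toFunctor) := by
  induction t using presented_induction e with
  | η x =>
    rw [monad_map_η, seqLaw_η, seqLaw_η, ← Delay.map_comp]
    exact (Delay.map_comp _ _ _).symm.trans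
      (congrArg (fun ψ => Delay.map ψ x) ((pointwiseMonad T).η.naturality φ))
  | op σ x ih =>
    rw [map_presentedOp, seqLaw_op, seqLaw_op,
      Delay.seqLift_map _ (fun _ x => presentedOp e σ x) (Functor.whiskerRight φ T.toFunctor)]
    · simp only [ih]
    · exact fun c x => map_presentedOp e (φ.app c) σ x

theorem seqLaw_now (X : Psh.{u}) (c : ClockCtx) (t : T.obj (X.obj c)) :
    seqLaw hA e X c (T.map (↾fun x : X.obj c => (Delay.now x : Delay X c)) t) =
      Delay.now (X := X ⋙ T.toFunctor) t := by
  induction t using presented_induction e with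
  | η x => rw [monad_map_η, seqLaw_η]; rfl
  | op σ x ih =>
    rw [map_presentedOp, seqLaw_op]
    simp only [ih]
    exact Delay.seqLift_now (X := X ⋙ T.toFunctor) _ c x

theorem seqLaw_μ (X : Psh.{u}) (c : ClockCtx) (t : T.obj (T.obj (Delay X c))) :
    seqLaw hA e X c (T.μ.app _ t) =
      (seqLaw hA e (X ⋙ T.toFunctor) c (T.map (↾seqLaw hA e X c) t)).map
        (pointwiseMult T X) := by
  induction t using presented_induction e with
  | η x =>
    rw [monad_μ_η, monad_map_η, seqLaw_η, ← Delay.map_comp]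
    exact (Delay.map_id _).symm.trans
      (congrArg (fun ψ => Delay.map ψ (seqLaw hA e X c x)) ((pointwiseMonad T).left_unit X).symm)
  | op σ x ih =>
    rw [μ_presentedOp, map_presentedOp, seqLaw_op, seqLaw_op,
      Delay.seqLift_map _ (fun _ x => presentedOp e σ x) (pointwiseMult T X)]
    · simp only [ih]
    · exact fun c x => μ_presentedOp e σ x

/-- `seqLaw`, as a morphism of presheaves. -/
noncomputable def seqLawNat (X : Psh.{u}) :
    Delay.psh X ⋙ T.toFunctor ⟶ Delay.psh (X ⋙ T.toFunctor) where
  app c := ↾seqLaw hA e X c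
  naturality c d g := by ext t; exact seqLaw_restrict hA e X g t

/-- Compatibility with the multiplication of the delay monad. The right-hand side is a homomorphism
because applying `join` to an iterated sequential lifting gives the sequential lifting. -/
theorem seqLaw_join (X : Psh.{u}) (c : ClockCtx) (t : T.obj (Delay (Delay.psh X) c)) :
    seqLaw hA e X c (T.map (↾fun x : Delay (Delay.psh X) c => x.join) t) =
      ((seqLaw hA e (Delay.psh X) c t).map (seqLawNat hA e X)).join := by
  induction t using presented_induction e with
  | η x =>
    rw [monad_map_η, seqLaw_η, seqLaw_η, ← Delay.map_comp]
    have : (pointwiseMonad T).η.app (Delay.psh X) ≫ seqLawNat hA e X =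
        Delay.pshMap (pointwiseUnit T X) := by
      ext c x
      exact seqLaw_η hA e X c x
    refine Eq.trans ?_ (congrArg (fun ψ => (Delay.map ψ x).join) this).symm
    exact (Delay.join_map _ x).symm
  | op σ x ih =>
    rw [map_presentedOp, seqLaw_op, seqLaw_op,
      Delay.seqLift_map (fun _ x => presentedOp e σ x) (Y := Delay.psh (X ⋙ T.toFunctor))
        (fun c y => Delay.seqLift (X := X ⋙ T.toFunctor) (fun _ x => presentedOp e σ x) c y)
        (seqLawNat hA e X) (fun c x => seqLaw_op hA e X c σ x)]
    refine Eq.trans ?_ (Delay.join_seqLift (X := X ⋙ T.toFunctor)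
      (fun _ x => presentedOp e σ x) _ (fun _ _ => rfl) _).symm
    simp only [ih]

/-- The distributive law given by sequential lifting. -/
noncomputable def seqDistributiveLaw :
    DistributiveLaw (pointwiseMonad T) guardedDelayMonad.{u} where
  nat :=
    { app := fun X => seqLawNat hA e X
      naturality := fun X Y φ => by ext c t; exact seqLaw_map hA e φ c t }
  unit_S X := by ext c x; exact seqLaw_η hA e X c x
  unit_T X := by ext c t; exact seqLaw_now hA e X c t
  mul_S X := by ext c t; exact seqLaw_μ hA e X c t
  mul_T X := by ext c t; exact seqLaw_join hA e X c t

theorem isSequential_seqDistributiveLaw : IsSequential e (seqDistributiveLaw hA e) :=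
  fun X c _ σ t => seqLaw_op hA e X c σ t

end Law

/-- A sequential distributive law is determined on generators by its compatibility with the unit,
and hence everywhere. -/
theorem IsSequential.unique {A : AlgTheory.{u}} {T : CategoryTheory.Monad (Type u)}
    {e : A.monad ≅ T} {ζ ζ' : DistributiveLaw (pointwiseMonad T) guardedDelayMonad.{u}}
    (h : IsSequential e ζ) (h' : IsSequential e ζ') : ζ = ζ' := by
  refine DistributiveLaw.ext (NatTrans.ext (funext fun X => NatTrans.ext (funext fun c =>
    ConcreteCategory.hom_ext _ _ fun t => ?_)))
  change T.obj (Delay X c) at t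
  induction t using presented_induction e with
  | η x =>
    exact (ConcreteCategory.congr_hom (NatTrans.congr_app (ζ.unit_S X) c) x).trans
      (ConcreteCategory.congr_hom (NatTrans.congr_app (ζ'.unit_S X) c) x).symm
  | op σ t ih =>
    refine (h X c _ σ t).trans (Eq.trans ?_ (h' X c _ σ t).symm)
    exact congrArg (Delay.seqLift (X := X ⋙ T.toFunctor) _ c) (funext ih)

/-! ### The coinductive delay type as the type of sections -/

section Ev

variable {X Y : Type u}

theorem ev_pure (c : ClockCtx) (a : X) :
    ev c (Computation.pure a) = Delay.now (X := const X) a := by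
  rw [ev, Computation.destruct_pure]

theorem ev_think (c : ClockCtx) (x : Computation X) :
    ev c x.think = Delay.step fun h => ev (c.tick h) x := by
  rw [ev, Computation.destruct_think]

theorem ev_restrict {c d : ClockCtx} (g : c ⟶ d) (x : Computation X) :
    (ev c x).restrict g = ev d x := by
  cases x using Computation.recOn with
  | pure a => rw [ev_pure, ev_pure]; rfl
  | think x =>
    rw [ev_think, ev_think]
    refine congrArg Delay.step (funext fun h => ?_)
    exact ev_restrict (tickMap g (h.trans_le (now_le g)) h) x
termination_by c.now
decreasing_by exact c.now_tick_lt (h.trans_le (now_le g))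

/-- The clock context consisting of a single clock with time `n`. -/
def single (n : ℕ) : ClockCtx := ⟨1, fun _ => n, 0⟩

/-- The morphism picking the distinguished clock. -/
def singleHom {n : ℕ} {c : ClockCtx} (h : c.now ≤ n) : single n ⟶ c where
  fn _ := c.clk
  time_le _ := h
  map_clk := rfl

/-- The value of a delayed element after at most `m` steps, if there is one. -/
def look : ℕ → {c : ClockCtx} → Delay (const X) c → Option X
  | _, _, .now x => some x
  | 0, _, .step _ => none
  | m + 1, c, .step e => if h : 0 < c.now then look m (e h) else none

theorem look_now (m : ℕ) {c : ClockCtx} (a : X) :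
    look m (Delay.now a : Delay (const X) c) = some a := by
  cases m <;> rfl

theorem look_restrict {m : ℕ} {c d : ClockCtx} (g : c ⟶ d) (hm : m ≤ d.now)
    (x : Delay (const X) c) : look m (x.restrict g) = look m x := by
  induction m generalizing c d with
  | zero => cases x <;> rfl
  | succ m ih =>
    cases x with
    | now a => rfl
    | step e =>
      have hd : 0 < d.now := by omega
      have hc : 0 < c.now := hd.trans_le (now_le g)
      simp only [Delay.restrict, look, dif_pos hd, dif_pos hc]
      exact ih _ (by rw [now_tick]; omega) _

theorem look_succ_of_look {m : ℕ} {c : ClockCtx} (hm : m < c.now) {x : Delay (const X) c} {a : X}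
    (h : look m x = some a) : look (m + 1) x = some a := by
  induction m generalizing c with
  | zero =>
    cases x with
    | now b => exact h
    | step e => cases h
  | succ m ih =>
    cases x with
    | now a => exact h
    | step e =>
      have hc : 0 < c.now := by omega
      rw [look, dif_pos hc] at h ⊢
      exact ih (by rw [now_tick]; omega) h

/-- A delayed element is determined by its values after the numbers of steps for which there is
time. -/
theorem look_ext {c : ClockCtx} {x y : Delay (const X) c}
    (h : ∀ m ≤ c.now, look m x = look m y) : x = y := by
  induction x with
  | @now c a =>
    have h0 := h 0 (Nat.zero_le _)
    cases y with
    | now b => exact congrArg Delay.now (Option.some.inj h0)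
    | step e => cases h0
  | @step c e ih =>
    cases y with
    | now b => cases h 0 (Nat.zero_le _)
    | step e' =>
      refine congrArg Delay.step (funext fun hc => ih hc fun m hm => ?_)
      have := h (m + 1) (by rw [now_tick] at hm; omega)
      simpa only [look, dif_pos hc] using this

theorem look_ev {m : ℕ} {c : ClockCtx} (hm : m ≤ c.now) (x : Computation X) :
    look m (ev c x) = x.runFor m := by
  induction m generalizing c x with
  | zero =>
    cases x using Computation.recOn with
    | pure a => rw [ev_pure, look_now]; rfl
    | think x => rw [ev_think]; rfl
  | succ m ih =>
    cases x using Computation.recOn with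
    | pure a => rw [ev_pure, look_now]; rfl
    | think x =>
      have hc : 0 < c.now := by omega
      rw [ev_think, look, dif_pos hc, ih (by rw [now_tick]; omega)]
      rfl

/-- An element of the coinductive delay type is determined by its evaluations. -/
theorem ev_jointly_injective {x y : Computation X} (h : ∀ c, ev c x = ev c y) : x = y := by
  have key (m : ℕ) : x.runFor m = y.runFor m := by
    have hm : m ≤ (single m).now := le_rfl
    rw [← look_ev hm, ← look_ev hm, h]
  exact Subtype.ext (funext key)

/-- Every section of the guarded delay type comes from an element of the coinductive one. At a
context with a single clock, the section is known up to the time on that clock. -/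
theorem exists_ev_eq {s : ∀ c, Delay (const X) c}
    (hs : ∀ {c d : ClockCtx} (g : c ⟶ d), (s c).restrict g = s d) :
    ∃ x : Computation X, ∀ c, ev c x = s c := by
  -- The value after `m` steps does not depend on the context, if there is time for `m` steps:
  -- compare with a single clock of time `c.now`, and then with one of time `m`.
  have hl {m : ℕ} {c : ClockCtx} (h : m ≤ c.now) : look m (s c) = look m (s (single m)) := by
    have h' : (single m).now ≤ c.now := h
    have hm : m ≤ (single m).now := le_rfl
    rw [← hs (singleHom (le_refl c.now)), look_restrict _ h, ← hs (singleHom h'),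
      look_restrict _ hm]
  obtain ⟨x, hx⟩ : ∃ x : Computation X, ∀ m, x.runFor m = look m (s (single m)) :=
    ⟨⟨fun m => look m (s (single m)), fun {m a} h =>
      look_succ_of_look (Nat.lt_succ_self m) ((hl (Nat.le_succ m)).trans h)⟩, fun _ => rfl⟩
  exact ⟨x, fun c => look_ext fun m hm => by rw [look_ev hm, hx, hl hm]⟩

theorem ev_map (f : X → Y) (c : ClockCtx) (x : Computation X) :
    ev c (x.map f) = (ev c x).map ((Functor.const ClockCtx).map (↾f)) := by
  cases x using Computation.recOn with
  | pure a => rw [Computation.map_pure, ev_pure, ev_pure]; rfl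
  | think x =>
    rw [Computation.map_think, ev_think, ev_think]
    exact congrArg Delay.step (funext fun h => ev_map f (c.tick h) x)
termination_by c.now
decreasing_by exact c.now_tick_lt h

/-- The evaluations, as a morphism of presheaves. -/
def evNat (X : Type u) : const (Computation X) ⟶ Delay.psh (const X) where
  app c := ↾fun x => ev c x
  naturality c d g := by ext x; exact (ev_restrict g x).symm

/-- The evaluations are compatible with the multiplications `· >>= id` and `join`. -/
theorem ev_bind_id (c : ClockCtx) (x : Computation (Computation X)) :
    ev c (x.bind id) = ((ev c x).map (evNat X)).join := by
  cases x using Computation.recOn with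
  | pure a => rw [Computation.ret_bind, ev_pure]; rfl
  | think x =>
    rw [Computation.think_bind, ev_think, ev_think]
    exact congrArg Delay.step (funext fun h => ev_bind_id (c.tick h) x)
termination_by c.now
decreasing_by exact c.now_tick_lt h

end Ev

/-! ### Induced laws for the coinductive delay monad -/

section Induced

variable {T : CategoryTheory.Monad (Type u)}
  (ζ : DistributiveLaw (pointwiseMonad T) guardedDelayMonad.{u})

/-- The components of a distributive law over the guarded delay monad, as functions. -/
def lawFun (X : Psh.{u}) (c : ClockCtx) (t : T.obj (Delay X c)) : Delay (X ⋙ T.toFunctor) c :=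
  (ζ.nat.app X).app c t

/-- A distributive law over the guarded delay monad, as morphisms of presheaves. -/
def lawNat (X : Psh.{u}) : Delay.psh X ⋙ T.toFunctor ⟶ Delay.psh (X ⋙ T.toFunctor) :=
  ζ.nat.app X

theorem lawFun_restrict (X : Psh.{u}) {c d : ClockCtx} (g : c ⟶ d) (t : T.obj (Delay X c)) :
    lawFun ζ X d (T.map (↾fun x : Delay X c => x.restrict g) t) = (lawFun ζ X c t).restrict g :=
  ConcreteCategory.congr_hom ((ζ.nat.app X).naturality g) t

theorem lawFun_map {X Y : Psh.{u}} (φ : X ⟶ Y) (c : ClockCtx) (t : T.obj (Delay X c)) :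
    lawFun ζ Y c (T.map (↾fun x : Delay X c => x.map φ) t) =
      (lawFun ζ X c t).map (Functor.whiskerRight φ T.toFunctor) :=
  ConcreteCategory.congr_hom (NatTrans.congr_app (ζ.nat.naturality φ) c) t

theorem lawFun_η (X : Psh.{u}) (c : ClockCtx) (x : Delay X c) :
    lawFun ζ X c (T.η.app _ x) = x.map (pointwiseUnit T X) :=
  ConcreteCategory.congr_hom (NatTrans.congr_app (ζ.unit_S X) c) x

theorem lawFun_now (X : Psh.{u}) (c : ClockCtx) (t : T.obj (X.obj c)) :
    lawFun ζ X c (T.map (↾fun x : X.obj c => (Delay.now x : Delay X c)) t) =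
      Delay.now (X := X ⋙ T.toFunctor) t :=
  ConcreteCategory.congr_hom (NatTrans.congr_app (ζ.unit_T X) c) t

theorem lawFun_μ (X : Psh.{u}) (c : ClockCtx) (t : T.obj (T.obj (Delay X c))) :
    lawFun ζ X c (T.μ.app _ t) =
      (lawFun ζ (X ⋙ T.toFunctor) c (T.map (↾lawFun ζ X c) t)).map (pointwiseMult T X) :=
  ConcreteCategory.congr_hom (NatTrans.congr_app (ζ.mul_S X) c) t

theorem lawFun_join (X : Psh.{u}) (c : ClockCtx) (t : T.obj (Delay (Delay.psh X) c)) :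
    lawFun ζ X c (T.map (↾fun x : Delay (Delay.psh X) c => x.join) t) =
      ((lawFun ζ (Delay.psh X) c t).map (lawNat ζ X)).join :=
  ConcreteCategory.congr_hom (NatTrans.congr_app (ζ.mul_T X) c) t

theorem monad_map_map (T : CategoryTheory.Monad (Type u)) {X Y Z : Type u} {f : X → Y} {g : Y → Z}
    {h : X → Z} (e : ∀ x, g (f x) = h x) (t : T.obj X) :
    T.map (↾g) (T.map (↾f) t) = T.map (↾h) t := by
  rw [← Functor.map_comp_apply]
  exact congrArg (fun k => T.map k t) (ConcreteCategory.hom_ext _ _ e)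

/-- The canonical isomorphism describing the action of `T` on constant presheaves. -/
abbrev constNat (T : CategoryTheory.Monad (Type u)) (X : Type u) :
    const X ⋙ T.toFunctor ⟶ const (T.obj X) :=
  (Functor.constComp ClockCtx X T.toFunctor).hom

/-- The elements `ζ (T (ev c) t)` for all contexts `c` form a section. -/
theorem exists_induced (X : Type u) (t : T.obj (Computation X)) :
    ∃ x : Computation (T.obj X), ∀ c,
      ev c x = (lawFun ζ (const X) c (T.map (↾fun x => ev c x) t)).map (constNat T X) := by
  refine exists_ev_eq fun {c d} g => ?_
  rw [← Delay.map_restrict, ← lawFun_restrict, monad_map_map T fun x => ev_restrict g x]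

/-- The components of the law induced on the coinductive delay monad. -/
noncomputable def inducedFun (X : Type u) (t : T.obj (Computation X)) : Computation (T.obj X) :=
  (exists_induced ζ X t).choose

theorem ev_inducedFun (X : Type u) (t : T.obj (Computation X)) (c : ClockCtx) :
    ev c (inducedFun ζ X t) =
      (lawFun ζ (const X) c (T.map (↾fun x => ev c x) t)).map (constNat T X) :=
  (exists_induced ζ X t).choose_spec c

theorem inducedFun_map {X Y : Type u} (f : X ⟶ Y) (t : T.obj (Computation X)) :
    inducedFun ζ Y (T.map (↾Computation.map f) t) = (inducedFun ζ X t).map (T.map f) := by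
  refine ev_jointly_injective fun c => ?_
  rw [ev_map, ev_inducedFun, ev_inducedFun, monad_map_map T fun x => ev_map f c x,
    ← monad_map_map T (f := fun x => ev c x)
      (g := fun x => Delay.map ((Functor.const ClockCtx).map f) x) fun x => rfl,
    lawFun_map, ← Delay.map_comp, ← Delay.map_comp]
  rfl

theorem inducedFun_η (X : Type u) (x : Computation X) :
    inducedFun ζ X (T.η.app _ x) = x.map (T.η.app X) := by
  refine ev_jointly_injective fun c => ?_
  rw [ev_map, ev_inducedFun, monad_map_η, lawFun_η, ← Delay.map_comp]
  refine congrArg (fun ψ => Delay.map ψ (ev c x)) ?_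
  ext c t
  rfl

theorem inducedFun_pure (X : Type u) (t : T.obj X) :
    inducedFun ζ X (T.map (↾Computation.pure) t) = Computation.pure t := by
  refine ev_jointly_injective fun c => ?_
  rw [ev_pure, ev_inducedFun, monad_map_map T fun x => ev_pure c x]
  exact congrArg (Delay.map (constNat T X)) (lawFun_now ζ (const X) c t)

theorem inducedFun_μ (X : Type u) (t : T.obj (T.obj (Computation X))) :
    inducedFun ζ X (T.μ.app _ t) =
      (inducedFun ζ (T.obj X) (T.map (↾inducedFun ζ X) t)).map (T.μ.app X) := by
  refine ev_jointly_injective fun c => ?_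
  rw [ev_map, ev_inducedFun, ev_inducedFun, monad_map_map T fun x => ev_inducedFun ζ X x c]
  have h1 : T.map (↾fun x => ev c x) (T.μ.app _ t) =
      T.μ.app _ (T.map (↾fun y => T.map (↾fun x : Computation X => ev c x) y) t) :=
    (ConcreteCategory.congr_hom (T.μ.naturality (↾fun x : Computation X => ev c x)) t).symm
  rw [h1, lawFun_μ, monad_map_map T fun x => rfl,
    ← monad_map_map T
      (f := fun x => lawFun ζ (const X) c (T.map (↾fun x => ev c x) x))
      (g := fun x => Delay.map (constNat T X) x) fun x => rfl,
    lawFun_map, ← Delay.map_comp, ← Delay.map_comp, ← Delay.map_comp]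
  congr 1
  ext c t
  simp
  rfl

/-- Compatibility with the multiplication of the delay monad. The defining property of the induced
law is used twice: for the outer delay, and, as an identity of morphisms of presheaves, for the
inner one. -/
theorem inducedFun_join (X : Type u) (t : T.obj (Computation (Computation X))) :
    inducedFun ζ X (T.map (↾fun x => Computation.bind x id) t) =
      ((inducedFun ζ (Computation X) t).map (inducedFun ζ X)).bind id := by
  refine ev_jointly_injective fun c => ?_
  rw [ev_bind_id, ev_map, ev_inducedFun, ev_inducedFun, monad_map_map T fun x => ev_bind_id c x,
    ← monad_map_map T (f := fun x => Delay.map (evNat X) (ev c x))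
      (g := fun x => Delay.join x) fun x => rfl, lawFun_join,
    ← monad_map_map T (f := fun x => ev c x)
      (g := fun x => Delay.map (evNat X) x) fun x => rfl, lawFun_map,
    ← Delay.join_map, ← Delay.map_comp, ← Delay.map_comp, ← Delay.map_comp, ← Delay.map_comp]
  congr 2
  ext c t
  exact (ev_inducedFun ζ X t c).symm

/-- The distributive law induced on the coinductive delay monad. -/
noncomputable def inducedLaw : DistributiveLaw T delayMonad.{u} where
  nat :=
    { app := fun X => ↾inducedFun ζ X
      naturality := fun X Y f => by ext t; exact inducedFun_map ζ f t }
  unit_S X := by ext x; exact inducedFun_η ζ X x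
  unit_T X := by ext t; exact inducedFun_pure ζ X t
  mul_S X := by ext t; exact inducedFun_μ ζ X t
  mul_T X := by ext t; exact inducedFun_join ζ X t

theorem isInducedBy_inducedLaw : IsInducedBy (inducedLaw ζ) ζ :=
  fun X t c => ev_inducedFun ζ X t c

variable {ζ} in
theorem IsInducedBy.unique {ξ ξ' : DistributiveLaw T delayMonad.{u}} (h : IsInducedBy ξ ζ)
    (h' : IsInducedBy ξ' ζ) : ξ = ξ' :=
  DistributiveLaw.ext (NatTrans.ext (funext fun X => TypeCat.homEquiv.injective
    (funext fun t : T.obj (Computation X) =>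
      ev_jointly_injective fun c => (h X t c).trans (h' X t c).symm)))

end Induced

/-! ### Presentations of trees, lists and multisets -/

/-- A criterion for a monad `M` to be presented by a theory: the sets `M X` are models generated by
`X`, `bind` consists of homomorphisms, and `X` is sent to the variables by a homomorphism to the
free model. -/
theorem nonempty_monad_iso {A : AlgTheory.{u}} {M : Type u → Type u} [_root_.Monad M]
    [LawfulMonad M] (I : ∀ {X : Type u} {n : ℕ}, A.Op n → (Fin n → M X) → M X)
    (hI : ∀ X, A.IsModel (Y := M X) I)
    (hb : ∀ {X Y : Type u} {n : ℕ} (σ : A.Op n) (x : Fin n → M X) (f : X → M Y),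
      I σ x >>= f = I σ fun i => x i >>= f)
    (hind : ∀ {X : Type u} {P : M X → Prop}, (∀ a, P (pure a)) →
      (∀ {n : ℕ} (σ : A.Op n) (x : Fin n → M X), (∀ i, P (x i)) → P (I σ x)) → ∀ x, P x)
    (ψ : ∀ {X : Type u}, M X → A.FreeModel X)
    (hψ_pure : ∀ {X : Type u} (a : X), ψ (pure a) = .mk (.var a))
    (hψ_op : ∀ {X : Type u} {n : ℕ} (σ : A.Op n) (x : Fin n → M X),
      ψ (I σ x) = .op σ fun i => ψ (x i)) :
    Nonempty (A.monad ≅ ofTypeMonad M) := by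
  let φ (X : Type u) : A.FreeModel X → M X := AlgTheory.FreeModel.lift I (hI X) pure
  have hφ_op {X : Type u} {n : ℕ} (σ : A.Op n) (x : Fin n → A.FreeModel X) :
      φ X (.op σ x) = I σ fun i => φ X (x i) := AlgTheory.FreeModel.lift_op _ _ _ _ _
  have hψφ (X : Type u) (x : A.FreeModel X) : ψ (φ X x) = x := by
    induction x using AlgTheory.FreeModel.ind with
    | h t =>
      induction t with
      | var a => exact hψ_pure a
      | op σ t ih => rw [← AlgTheory.FreeModel.op_mk, hφ_op, hψ_op]; simp only [ih]
  have hφψ (X : Type u) (x : M X) : φ X (ψ x) = x := by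
    refine hind (P := fun x => φ X (ψ x) = x) (fun a => ?_) (fun σ x ih => ?_) x
    · rw [hψ_pure]; rfl
    · rw [hψ_op, hφ_op]; simp only [ih]
  have hφ_bind {X Y : Type u} (f : X → A.FreeModel Y) (x : A.FreeModel X) :
      φ Y (.lift (fun {_} => .op) AlgTheory.FreeModel.isModel f x) =
        φ X x >>= fun a => φ Y (f a) := by
    induction x using AlgTheory.FreeModel.ind with
    | h t =>
      induction t with
      | var a => exact (pure_bind a fun a => φ Y (f a)).symm
      | op σ t ih =>
        rw [← AlgTheory.FreeModel.op_mk, AlgTheory.FreeModel.lift_op, hφ_op, hφ_op, hb]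
        exact congrArg (I σ) (funext ih)
  have hφ_map {X Y : Type u} (f : X → Y) (x : A.FreeModel X) :
      φ Y (.map f x) = f <$> φ X x :=
    (hφ_bind _ x).trans (bind_pure_comp f (φ X x))
  refine ⟨MonadIso.mk (NatIso.ofComponents
    (fun X => (Equiv.mk (φ X) ψ (hψφ X) (hφψ X)).toIso) fun {X Y} f => ?_)
    (fun X => ?_) fun X => ?_⟩
  · ext x
    exact hφ_map f x
  · ext x
    rfl
  · ext x
    refine (hφ_bind id x).trans (Eq.trans ?_ (congrArg joinM (hφ_map (φ X) x)).symm)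
    simp [joinM]

section MonoidOps

variable {X : Type v} {Y : Type w}

theorem occ_oneTm [DecidableEq X] (x : X) : oneTm.{u}.occ x = 0 := by
  simp [oneTm, Term.occ]

theorem occ_mulTm [DecidableEq X] (x : X) (s t : Term MonoidOp.{u} X) :
    (mulTm s t).occ x = s.occ x + t.occ x := by
  simp [mulTm, Term.occ]

theorem unitEqns_isBalanced {s t : Term MonoidOp.{u} (Fin 1)} (h : (s, t) ∈ unitEqns) (x : Fin 1) :
    s.occ x = t.occ x := by
  obtain h | h := h <;> obtain ⟨rfl, rfl⟩ := Prod.mk.inj h <;> simp [occ_mulTm, occ_oneTm]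

theorem magmaTheory_isBalanced : magmaTheory.{u}.IsBalanced
  | 1, _, _, h, x => unitEqns_isBalanced h x

theorem monoidTheory_isBalanced : monoidTheory.{u}.IsBalanced
  | 1, _, _, h, x => unitEqns_isBalanced h x
  | 3, _, _, h, x => by
    obtain ⟨rfl, rfl⟩ := Prod.mk.inj h
    change (mulTm _ _).occ x = (mulTm _ _).occ x
    simp only [occ_mulTm, add_assoc]

theorem commMonoidTheory_isBalanced : commMonoidTheory.{u}.IsBalanced
  | 1, _, _, h, x => unitEqns_isBalanced h x
  | 2, _, _, h, x => by
    obtain ⟨rfl, rfl⟩ := Prod.mk.inj h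
    change (mulTm _ _).occ x = (mulTm _ _).occ x
    simp only [occ_mulTm, add_comm]
  | 3, s, t, h, x => monoidTheory_isBalanced 3 s t h x

theorem eval_oneTm (I : ∀ {n : ℕ}, MonoidOp.{u} n → (Fin n → Y) → Y) (ρ : X → Y) :
    oneTm.eval I ρ = I .one ![] :=
  congrArg (I .one) (Subsingleton.elim _ _)

theorem eval_mulTm (I : ∀ {n : ℕ}, MonoidOp.{u} n → (Fin n → Y) → Y) (ρ : X → Y)
    (s t : Term MonoidOp X) :
    (mulTm s t).eval I ρ = I .mul ![s.eval I ρ, t.eval I ρ] :=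
  congrArg (I .mul) (funext fun i => by fin_cases i <;> rfl)

/-- The interpretation of the constant and the binary operation in a multiplicative structure. -/
def monoidInterp [One Y] [Mul Y] : ∀ {n : ℕ}, MonoidOp.{u} n → (Fin n → Y) → Y
  | _, .one, _ => 1
  | _, .mul, x => x 0 * x 1

theorem eval_unitEqns [MulOneClass Y] {s t : Term MonoidOp.{u} (Fin 1)} (h : (s, t) ∈ unitEqns)
    (ρ : Fin 1 → Y) : s.eval monoidInterp ρ = t.eval monoidInterp ρ := by
  obtain h | h := h <;> obtain ⟨rfl, rfl⟩ := Prod.mk.inj h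
  · exact one_mul (ρ 0)
  · exact mul_one (ρ 0)

theorem magmaTheory_isModel [MulOneClass Y] : magmaTheory.{u}.IsModel (Y := Y) monoidInterp
  | 1, _, _, h, ρ => eval_unitEqns h ρ

theorem monoidTheory_isModel [Monoid Y] : monoidTheory.{u}.IsModel (Y := Y) monoidInterp
  | 1, _, _, h, ρ => eval_unitEqns h ρ
  | 3, _, _, h, ρ => by
    obtain ⟨rfl, rfl⟩ := Prod.mk.inj h
    exact mul_assoc (ρ 0) (ρ 1) (ρ 2)

theorem commMonoidTheory_isModel [CommMonoid Y] :
    commMonoidTheory.{u}.IsModel (Y := Y) monoidInterp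
  | 1, _, _, h, ρ => eval_unitEqns h ρ
  | 2, _, _, h, ρ => by
    obtain ⟨rfl, rfl⟩ := Prod.mk.inj h
    exact mul_comm (ρ 0) (ρ 1)
  | 3, s, t, h, ρ => monoidTheory_isModel 3 s t h ρ

/-- A map that preserves the constant and the binary operation preserves all operations. -/
theorem map_monoidInterp [One X] [Mul X] (I : ∀ {n : ℕ}, MonoidOp.{u} n → (Fin n → Y) → Y)
    (f : X → Y) (h_one : f 1 = I .one ![]) (h_mul : ∀ x y, f (x * y) = I .mul ![f x, f y]) {n : ℕ}
    (σ : MonoidOp.{u} n) (x : Fin n → X) : f (monoidInterp σ x) = I σ fun i => f (x i) := by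
  cases σ with
  | one => exact h_one.trans (congrArg (I .one) (Subsingleton.elim _ _))
  | mul => exact (h_mul _ _).trans (congrArg (I .mul) (funext fun i => by fin_cases i <;> rfl))

/-- The multiplicative structure of a set on which the constant and the binary operation act so
that the unit laws hold. -/
abbrev mulOneClassOfInterp (I : ∀ {n : ℕ}, MonoidOp.{u} n → (Fin n → Y) → Y)
    (h : ∀ s t, (s, t) ∈ unitEqns → ∀ ρ : Fin 1 → Y, s.eval I ρ = t.eval I ρ) :
    MulOneClass Y where
  one := I .one ![]
  mul x y := I .mul ![x, y]
  one_mul x := by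
    have := h _ _ (.inl rfl) fun _ => x
    rwa [eval_mulTm, eval_oneTm] at this
  mul_one x := by
    have := h _ _ (.inr rfl) fun _ => x
    rwa [eval_mulTm, eval_oneTm] at this

/-- The multiplicative structure of a set on which the constant and the binary operation act so
that the unit and associative laws hold. -/
abbrev monoidOfInterp (I : ∀ {n : ℕ}, MonoidOp.{u} n → (Fin n → Y) → Y)
    (h : ∀ s t, (s, t) ∈ unitEqns → ∀ ρ : Fin 1 → Y, s.eval I ρ = t.eval I ρ)
    (h_assoc : ∀ ρ : Fin 3 → Y, assocEqn.1.eval I ρ = assocEqn.2.eval I ρ) : Monoid Y :=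
  letI := mulOneClassOfInterp I h
  { mul_assoc x y z := by
      have := h_assoc ![x, y, z]
      simp only [assocEqn, eval_mulTm] at this
      exact this
    one_mul := one_mul
    mul_one := mul_one }

/-- The multiplicative structure of a set on which the constant and the binary operation act so
that the unit, associative and commutative laws hold. -/
abbrev commMonoidOfInterp (I : ∀ {n : ℕ}, MonoidOp.{u} n → (Fin n → Y) → Y)
    (h : ∀ s t, (s, t) ∈ unitEqns → ∀ ρ : Fin 1 → Y, s.eval I ρ = t.eval I ρ)
    (h_assoc : ∀ ρ : Fin 3 → Y, assocEqn.1.eval I ρ = assocEqn.2.eval I ρ)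
    (h_comm : ∀ ρ : Fin 2 → Y, commEqn.1.eval I ρ = commEqn.2.eval I ρ) : CommMonoid Y where
  __ := monoidOfInterp I h h_assoc
  mul_comm x y := by
    have := h_comm ![x, y]
    simp only [commEqn, eval_mulTm] at this
    exact this

noncomputable instance (X : Type v) : MulOneClass (magmaTheory.{u}.FreeModel X) :=
  mulOneClassOfInterp (fun {_} σ => AlgTheory.FreeModel.op (A := magmaTheory.{u}) σ)
    fun s t h => AlgTheory.FreeModel.isModel (A := magmaTheory.{u}) 1 s t h

noncomputable instance (X : Type v) : Monoid (monoidTheory.{u}.FreeModel X) :=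
  monoidOfInterp (fun {_} σ => AlgTheory.FreeModel.op (A := monoidTheory.{u}) σ)
    (fun s t h => AlgTheory.FreeModel.isModel (A := monoidTheory.{u}) 1 s t h)
    (AlgTheory.FreeModel.isModel (A := monoidTheory.{u}) 3 _ _ rfl)

noncomputable instance (X : Type v) : CommMonoid (commMonoidTheory.{u}.FreeModel X) :=
  commMonoidOfInterp (fun {_} σ => AlgTheory.FreeModel.op (A := commMonoidTheory.{u}) σ)
    (fun s t h => AlgTheory.FreeModel.isModel (A := commMonoidTheory.{u}) 1 s t h)
    (AlgTheory.FreeModel.isModel (A := commMonoidTheory.{u}) 3 _ _ rfl)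
    (AlgTheory.FreeModel.isModel (A := commMonoidTheory.{u}) 2 _ _ rfl)

end MonoidOps

theorem nonempty_magmaTheory_monad_iso :
    Nonempty (magmaTheory.{u}.monad ≅ ofTypeMonad BinTree.{u}) := by
  refine nonempty_monad_iso (A := magmaTheory.{u}) (M := BinTree.{u})
    (fun {X n} => monoidInterp (Y := WithOne (FreeMagma X)))
    (fun X => magmaTheory_isModel (Y := WithOne (FreeMagma X)))
    (fun {X Y n} σ x f => ?_) (fun {X P} hp ho x => ?_)
    (fun {X} => WithOne.lift (FreeMagma.lift fun a => .mk (.var a)))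
    (fun {X} a => ?_) (fun {X n} σ x => ?_)
  · exact map_monoidInterp (Y := WithOne (FreeMagma Y)) monoidInterp
      (WithOne.lift (β := WithOne (FreeMagma Y)) (FreeMagma.lift f)) (map_one _)
      (fun x y => map_mul _ x y) σ x
  · have h_mul (x y : WithOne (FreeMagma X)) (hx : P x) (hy : P y) : P (x * y) :=
      ho MonoidOp.mul ![x, y] fun i => by fin_cases i <;> assumption
    induction x using WithOne.recOneCoe with
    | one => exact ho MonoidOp.one ![] fun i => i.elim0
    | coe m =>
      induction m with
      | ih1 a => exact hp a
      | ih2 a b ha hb => exact h_mul _ _ ha hb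
  · rfl
  · let g : WithOne (FreeMagma X) →* magmaTheory.{u}.FreeModel X :=
      WithOne.lift (FreeMagma.lift fun a => .mk (.var a))
    exact map_monoidInterp _ g (map_one g) (map_mul g) σ x

theorem nonempty_monoidTheory_monad_iso :
    Nonempty (monoidTheory.{u}.monad ≅ ofTypeMonad List.{u}) := by
  refine nonempty_monad_iso (A := monoidTheory.{u}) (M := List.{u})
    (fun {X n} => monoidInterp (Y := FreeMonoid X))
    (fun X => monoidTheory_isModel (Y := FreeMonoid X))
    (fun {X Y n} σ x f => ?_) (fun {X P} hp ho x => ?_)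
    (fun {X} => FreeMonoid.lift fun a => .mk (.var a))
    (fun {X} a => ?_) (fun {X n} σ x => ?_)
  · exact map_monoidInterp (X := FreeMonoid X) (Y := FreeMonoid Y) monoidInterp
      (fun l => List.flatMap f l) rfl (fun _ _ => List.flatMap_append) σ x
  · have h_mul (x y : List X) (hx : P x) (hy : P y) : P (x ++ y) :=
      ho MonoidOp.mul ![x, y] fun i => by fin_cases i <;> assumption
    induction x with
    | nil => exact ho MonoidOp.one ![] fun i => i.elim0
    | cons a l ih => exact h_mul [a] l (hp a) ih
  · rfl
  · let g : FreeMonoid X →* monoidTheory.{u}.FreeModel X :=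
      FreeMonoid.lift fun a => .mk (.var a)
    exact map_monoidInterp _ g (map_one g) (map_mul g) σ x

theorem nonempty_commMonoidTheory_monad_iso :
    Nonempty (commMonoidTheory.{u}.monad ≅ ofTypeMonad Multiset.{u}) := by
  refine nonempty_monad_iso (A := commMonoidTheory.{u}) (M := Multiset.{u})
    (fun {X n} => monoidInterp (Y := Multiplicative (Multiset X)))
    (fun X => commMonoidTheory_isModel (Y := Multiplicative (Multiset X)))
    (fun {X Y n} σ x f => ?_) (fun {X P} hp ho x => ?_)
    (fun {X} s => (s.map fun a => AlgTheory.FreeModel.mk (.var a)).prod)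
    (fun {X} a => ?_) (fun {X n} σ x => ?_)
  · exact map_monoidInterp (X := Multiplicative (Multiset X)) (Y := Multiplicative (Multiset Y))
      monoidInterp (fun s => Multiset.bind s f) (Multiset.zero_bind f)
      (fun s t => Multiset.add_bind s t f) σ x
  · have h_mul (x y : Multiset X) (hx : P x) (hy : P y) : P (x + y) :=
      ho MonoidOp.mul ![x, y] fun i => by fin_cases i <;> assumption
    induction x using Multiset.induction with
    | empty => exact ho MonoidOp.one ![] fun i => i.elim0
    | cons a s ih => exact h_mul {a} s (hp a) ih
  · exact Multiset.prod_singleton _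
  · refine map_monoidInterp (X := Multiplicative (Multiset X)) _
      (fun s : Multiset X => (s.map fun a => AlgTheory.FreeModel.mk (.var a)).prod) ?_ ?_ σ x
    · exact Multiset.prod_zero
    · intro s t
      exact (congrArg Multiset.prod (Multiset.map_add _ s t)).trans (Multiset.prod_add _ _)

end GuardedDelay

theorem theorem5p6 :
    (∀ A : GuardedDelay.AlgTheory.{u}, A.IsBalanced →
      ∀ (T : CategoryTheory.Monad (Type u)) (e : A.monad ≅ T),
      ∃ ζ : GuardedDelay.DistributiveLaw (GuardedDelay.pointwiseMonad T)
          GuardedDelay.guardedDelayMonad.{u},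
        GuardedDelay.IsSequential e ζ ∧
        (∀ ζ', GuardedDelay.IsSequential e ζ' → ζ' = ζ) ∧
        ∃! ξ : GuardedDelay.DistributiveLaw T GuardedDelay.delayMonad.{u},
          GuardedDelay.IsInducedBy ξ ζ) ∧
    (∀ X : Type u, ∀ s ∈ (GuardedDelay.Delay.psh (GuardedDelay.const X)).sections,
      ∃! x : Computation X, ∀ c : GuardedDelay.ClockCtx, GuardedDelay.ev c x = s c) ∧
    (GuardedDelay.magmaTheory.{u}.IsBalanced ∧
      Nonempty (GuardedDelay.magmaTheory.{u}.monad ≅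
        CategoryTheory.ofTypeMonad GuardedDelay.BinTree.{u})) ∧
    (GuardedDelay.monoidTheory.{u}.IsBalanced ∧
      Nonempty (GuardedDelay.monoidTheory.{u}.monad ≅ CategoryTheory.ofTypeMonad List.{u})) ∧
    (GuardedDelay.commMonoidTheory.{u}.IsBalanced ∧
      Nonempty (GuardedDelay.commMonoidTheory.{u}.monad ≅
        CategoryTheory.ofTypeMonad Multiset.{u})) := by
  refine ⟨fun A hA T e => ⟨GuardedDelay.seqDistributiveLaw hA e,
      GuardedDelay.isSequential_seqDistributiveLaw hA e,
      fun ζ' h => h.unique (GuardedDelay.isSequential_seqDistributiveLaw hA e),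
      GuardedDelay.inducedLaw _, GuardedDelay.isInducedBy_inducedLaw _,
      fun ξ' h => h.unique (GuardedDelay.isInducedBy_inducedLaw _)⟩,
    fun X s hs => ?_,
    ⟨GuardedDelay.magmaTheory_isBalanced, GuardedDelay.nonempty_magmaTheory_monad_iso⟩,
    ⟨GuardedDelay.monoidTheory_isBalanced, GuardedDelay.nonempty_monoidTheory_monad_iso⟩,
    ⟨GuardedDelay.commMonoidTheory_isBalanced, GuardedDelay.nonempty_commMonoidTheory_monad_iso⟩⟩
  obtain ⟨x, hx⟩ := GuardedDelay.exists_ev_eq (s := s) fun g => hs g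
  exact ⟨x, hx, fun y hy => GuardedDelay.ev_jointly_injective fun c => (hy c).trans (hx c).symm⟩
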